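/- **Notation.** Let $\mathcal Z\subseteq\mathbb R^d$ be closed, with the Euclidean norm, and let $\mathcal P(\mathcal Z)$ be the set of Borel probability measures on $\mathcal Z$. For $p\ge 1$ let $W_p(\mu,\nu)=\inf_{\pi}\big(\mathbb E_\pi\|X-Y\|^p\big)^{1/p}$, the infimum being over couplings $\pi$ of $\mu,\nu\in\mathcal P(\mathcal Z)$ (value $+\infty$ allowed), and let $\|\mu-\nu\|_{TV}=\frac12|\mu-\nu|(\mathcal Z)$. For $\varepsilon\in[0,1)$ put $$W_p^\varepsilon(\mu,\nu)=\inf_{\mu'\in\mathcal P(\mathcal Z):\ \|\mu'-\mu\|_{TV}\le\varepsilon}W_p(\mu',\nu),\qquad W_p^\varepsilon(\mu\|\nu)=\inf_{\mu'\in\mathcal P(\mathcal Z):\ \mu'\le\frac1{1-\varepsilon}\mu}W_p(\mu',\nu),$$ and, for $\mathcal H\subseteq\mathcal P(\mathcal Z)$, $\tau_p(\mathcal H,\varepsilon)=\sup_{\mu\in\mathcal H}\ \sup_{\mu'\in\mathcal P(\mathcal Z):\ \mu'\le\frac1{1-\varepsilon}\mu}W_p(\mu',\mu)$. Let $\mathcal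 G_{cov}$ be the set of $\mu\in\mathcal P(\mathcal Z)$ with finite second moment and covariance matrix $\Sigma_\mu\preceq I_d$, and let $\mathcal G_2(\sigma,z_0)=\{\nu\in\mathcal P(\mathcal Z):\mathbb E_\nu\|Z-z_0\|^2\le\sigma^2\}$. **Setting.** Let $p\in\{1,2\}$, $\varepsilon\in[0,0.49]$, $\rho_0,\delta\ge 0$. Let $\mathcal L$ be a family of lower semicontinuous functions $\ell:\mathcal Z\to\mathbb R$ with $\sup_{z\in\mathcal Z}\ell(z)/(1+\|z\|^p)<\infty$. Let $\mathcal G\subseteq\mathcal G_{cov}$ and $\mu\in\mathcal G$, let $\hat\mu_n$ be the empirical measure of $n\ge1$ points $Z_1,\dots,Z_n\in\mathcal Z$ (a realization of the clean sample from $\mu$) with $W_p(\hat\mu_n,\mu)\le\delta$, and let $\tilde\mu_n$ be the empirical measure of $n$ points $\tilde Z_1,\dots,\tilde Z_n\in\mathcal Z$ (the corrupted sample) with $W_p^\varepsilon(\tilde\mu_n,\hat\mu_n)\le\rho_0$. Let $z_0\in\mathcal Z$ satisfy $\|z_0-\mathbb E_\mu[Z]\|\le E\le C_0(\rho_0+\sqrt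 d)$. Put $$\rho=(\rho_0+\delta)(1-\varepsilon)^{-1/p}+\tau_p(\mathcal G_{cov},\varepsilon),\qquad \sigma=\sqrt d+E .$$ Let $\hat\ell\in\mathcal L$ minimize over $\ell\in\mathcal L$ the quantity $\sup\{\mathbb E_\nu[\ell]:\nu\in\mathcal G_2(\sigma,z_0),\ W_p^\varepsilon(\tilde\mu_n\|\nu)\le\rho\}$, and let $\ell_\star\in\mathcal L$ minimize $\mathbb E_\mu[\ell]$ over $\ell\in\mathcal L$; here expectations take values in $[-\infty,\infty)$. **Claim.** For every $C_0$ there is a constant $C$, depending only on $C_0$ (in particular not on $d,\mathcal Z,\varepsilon,\rho_0,\delta,n,\mu,\mathcal L$), such that in this setting the following hold. 1. If $p=1$ and $\ell_\star$ is Lipschitz, with least Lipschitz constant $\|\ell_\star\|_{Lip}$, then $\hat\ell$ and $\ell_\star$ are $\mu$-integrable and $$\mathbb E_\mu[\hat\ell]-\mathbb E_\mu[\ell_\star]\le C\,\|\ell_\star\|_{Lip}\big(\rho_0+\sqrt{d\varepsilon}+\delta\big).$$ 2. If $p=2$ and $\ell_\star$ is $\alpha$-smooth ($\alpha\ge0$),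 then $\hat\ell$ and $\ell_\star$ are $\mu$-integrable and $$\mathbb E_\mu[\hat\ell]-\mathbb E_\mu[\ell_\star]\le C\Big(\|\ell_\star\|_{\dot H^{1,2}(\mu)}\big(\rho_0+\sqrt d+\delta\big)+\alpha\big(\rho_0+\sqrt d+\delta\big)^2\Big),\qquad \|\ell_\star\|_{\dot H^{1,2}(\mu)}=\mathbb E_\mu\big[\|\nabla\ell_\star\|^2\big]^{1/2}.$$ Here $\ell_\star$ is called $\alpha$-smooth if it extends to a differentiable function on the convex hull $\mathrm{conv}(\mathcal Z)$ (no extension is needed if $\mathcal Z$ is convex) with a gradient field $\nabla\ell_\star$, differentiability being relative to $\mathrm{conv}(\mathcal Z)$, that satisfies $\|\nabla\ell_\star(z)-\nabla\ell_\star(z')\|\le\alpha\|z-z'\|$ for all $z,z'\in\mathrm{conv}(\mathcal Z)$; the bound holds for every such extension and gradient field. -/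

import Mathlib

open MeasureTheory ProbabilityTheory
open scoped ENNReal NNReal

noncomputable section

namespace RobustDRO

section General

variable {X : Type*} [MeasurableSpace X]

/-- The empirical measure `(1/n) ∑ i, δ_{x i}` of `n ≥ 1` points. -/
def empirical {n : ℕ} [NeZero n] (x : Fin n → X) : ProbabilityMeasure X :=
  ⟨(n : ℝ≥0∞)⁻¹ • ∑ i, Measure.dirac (x i), ⟨by
    simp only [Measure.smul_apply, Measure.finsetSum_apply, measure_univ,
      Finset.sum_const, Finset.card_univ, Fintype.card_fin, smul_eq_mul, nsmul_eq_mul, mul_one]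
    exact ENNReal.inv_mul_cancel (by exact_mod_cast NeZero.ne n) (ENNReal.natCast_ne_top n)⟩⟩

/-- The total variation distance `‖μ - ν‖_TV = |μ - ν|(X) / 2`. -/
def tvDist (μ ν : ProbabilityMeasure X) : ℝ≥0∞ :=
  ((μ : Measure X).toSignedMeasure - (ν : Measure X).toSignedMeasure).totalVariation Set.univ / 2

/-- The couplings of `μ` and `ν`. -/
def couplings (μ ν : ProbabilityMeasure X) : Set (ProbabilityMeasure (X × X)) :=
  {π | (π : Measure (X × X)).fst = μ ∧ (π : Measure (X × X)).snd = ν}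

/-- The expectation `E_ν[f]` in `[-∞, ∞]`: the integral of the positive part minus the integral of
the negative part (used for functions whose positive part has finite integral). -/
def expect (ν : ProbabilityMeasure X) (f : X → ℝ) : EReal :=
  ((∫⁻ x, ENNReal.ofReal (f x) ∂(ν : Measure X) : ℝ≥0∞) : EReal) -
    ((∫⁻ x, ENNReal.ofReal (-f x) ∂(ν : Measure X) : ℝ≥0∞) : EReal)

/-- The probability measures `μ'` with `μ' ≤ (1 - ε)⁻¹ μ` setwise. -/
def trimmings (ε : ℝ) (μ : ProbabilityMeasure X) : Set (ProbabilityMeasure X) :=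
  {μ' | (μ' : Measure X) ≤ ENNReal.ofReal (1 - ε)⁻¹ • (μ : Measure X)}

variable [PseudoEMetricSpace X]

/-- The `p`-Wasserstein distance, with value `∞` if no coupling has finite cost. -/
def wass (p : ℝ) (μ ν : ProbabilityMeasure X) : ℝ≥0∞ :=
  ⨅ π ∈ couplings μ ν, (∫⁻ z, edist z.1 z.2 ^ p ∂(π : Measure (X × X))) ^ (1 / p)

/-- The `ε`-outlier-robust `p`-Wasserstein distance `W_p^ε(μ, ν)`. -/
def robustWass (p ε : ℝ) (μ ν : ProbabilityMeasure X) : ℝ≥0∞ :=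
  ⨅ (μ' : ProbabilityMeasure X) (_ : tvDist μ' μ ≤ ENNReal.ofReal ε), wass p μ' ν

/-- The one-sided robust distance `W_p^ε(μ ‖ ν)`. -/
def oneSidedRobustWass (p ε : ℝ) (μ ν : ProbabilityMeasure X) : ℝ≥0∞ :=
  ⨅ μ' ∈ trimmings ε μ, wass p μ' ν

/-- The `p`-Wasserstein resilience `τ_p(𝒢, ε)` of a family of probability measures. -/
def resilience (p : ℝ) (𝒢 : Set (ProbabilityMeasure X)) (ε : ℝ) : ℝ≥0∞ :=
  ⨆ μ ∈ 𝒢, ⨆ μ' ∈ trimmings ε μ, wass p μ' μ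

/-- The class `𝒢₂(σ, z₀)` of all `ν` with `E_ν ‖Z - z₀‖² ≤ σ²`. -/
def secondMomentClass (σ : ℝ) (z₀ : X) : Set (ProbabilityMeasure X) :=
  {ν | ∫⁻ z, edist z z₀ ^ 2 ∂(ν : Measure X) ≤ ENNReal.ofReal (σ ^ 2)}

/-- The objective of the modified robust problem: the worst-case risk of `ℓ` over all
`ν ∈ 𝒢₂(σ, z₀)` with `W_p^ε(μ̃ ‖ ν) ≤ ρ`. -/
def worstRisk (p ε σ : ℝ) (ρ : ℝ≥0∞) (z₀ : X) (μt : ProbabilityMeasure X) (f : X → ℝ) : EReal :=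
  ⨆ ν ∈ {ν ∈ secondMomentClass σ z₀ | oneSidedRobustWass p ε μt ν ≤ ρ}, expect ν f

/-- The Lipschitz seminorm (the least Lipschitz constant) of a Lipschitz function. -/
def lipSeminorm (f : X → ℝ) : ℝ≥0 := sInf {K : ℝ≥0 | LipschitzWith K f}

end General

section Euclidean

variable {d : ℕ} {Z : Set (EuclideanSpace ℝ (Fin d))}

/-- The mean `E_μ[Z]`, a vector of `ℝ^d` (not necessarily in `Z`). -/
def mean (μ : ProbabilityMeasure Z) : EuclideanSpace ℝ (Fin d) :=
  ∫ z, (z : EuclideanSpace ℝ (Fin d)) ∂(μ : Measure Z)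

/-- The covariance matrix `Σ_μ`. -/
def covMatrix (μ : ProbabilityMeasure Z) : Matrix (Fin d) (Fin d) ℝ :=
  Matrix.of fun i j =>
    covariance (fun z : Z => (z : EuclideanSpace ℝ (Fin d)) i)
      (fun z : Z => (z : EuclideanSpace ℝ (Fin d)) j) (μ : Measure Z)

/-- The class `𝒢_cov` of probability measures on `Z` with finite second moment and
covariance matrix `Σ_μ ⪯ I_d`. -/
def covClass (Z : Set (EuclideanSpace ℝ (Fin d))) : Set (ProbabilityMeasure Z) :=
  {μ | MemLp (fun z : Z => (z : EuclideanSpace ℝ (Fin d))) 2 (μ : Measure Z) ∧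
    (1 - covMatrix μ).PosSemidef}

/-- `f` is `α`-smooth on the set `K`, with gradient field `g`: `f` is differentiable on `K` with
gradient `g`, and `g` is `α`-Lipschitz (in particular continuous) on `K`. -/
structure IsSmoothOn (α : ℝ≥0) (K : Set (EuclideanSpace ℝ (Fin d)))
    (f : EuclideanSpace ℝ (Fin d) → ℝ)
    (g : EuclideanSpace ℝ (Fin d) → EuclideanSpace ℝ (Fin d)) : Prop where
  hasGradient : ∀ z ∈ K, HasGradientWithinAt f (g z) K z
  lipschitz : LipschitzOnWith α g K

/-- The homogeneous Sobolev seminorm `E_μ[‖∇f‖²]^(1/2)` of a function with gradient field `g`. -/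
def sobolevSeminorm (μ : ProbabilityMeasure Z)
    (g : EuclideanSpace ℝ (Fin d) → EuclideanSpace ℝ (Fin d)) : ℝ :=
  √(∫ z : Z, ‖g z‖ ^ 2 ∂(μ : Measure Z))

end Euclidean

end RobustDRO

end

/-! The argument is a minimax comparison. If the clean law `μ` is feasible, then E_μ[ℓhat] ≤ worst
risk of ℓhat ≤ worst risk of ℓstar, so the excess risk is at most the largest value of E_ν[ℓstar] -
E_μ[ℓstar] over feasible `ν`. Only the regularity of ℓstar matters, and it suffices that every
feasible `ν` be `W_p`-close to `μ` (`integrable_and_integral_sub_le`, `feasible_and_wass_le`).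

Both facts rest on trimmings. Measures that overlap in mass at least 1 - ε have a common ε-trimming
(`exists_common_trimming`), and a trimming can be pushed along a coupling to a trimming of the other
marginal, at the cost of a factor (1 - ε)^(-1/p) (`exists_trimming_wass_le`). Feasibility of `μ`:
trim the corrupted sample and its TV-repair in common, transport to a trimming of `μ`, then return
to `μ` by resilience. Closeness of `ν`: the trimmings of the corrupted sample near `μ` and near `ν`
overlap, so they share an ε/(1 - ε)-trimming, which is transported to trimmings of `μ` and of `ν`.
The second-moment constraint makes `ν` resilient as well.

Resilience of a law with second moment s² about a centre is of order √ε s for p = 1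
(`wass_one_le_seven_mul`) and s for p = 2 (`wass_two_le_seven_mul`). Closeness becomes a risk bound
through the Lipschitz inequality when p = 1, and through a first-order expansion at the `μ`-point
with Cauchy-Schwarz when p = 2. -/

namespace RobustDRO

/-! ### Gluing and marginals of couplings. -/

section Couplings

variable {X : Type*} [MeasurableSpace X]

lemma fst_glue (π₁ : Measure (X × X)) [SFinite π₁] (κ : Kernel X X) [IsMarkovKernel κ] :
    (π₁ ⊗ₘ κ.comap Prod.snd measurable_snd).map Prod.fst = π₁ :=
  Measure.fst_compProd π₁ _

/-- The third point is drawn from the second alone. When `κ` disintegrates a coupling whose first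
marginal is `π₁.snd`, that coupling is recovered on the last two coordinates. -/
lemma map_glue (π₁ : Measure (X × X)) [SFinite π₁] (κ : Kernel X X) [IsMarkovKernel κ] :
    (π₁ ⊗ₘ κ.comap Prod.snd measurable_snd).map (fun q => (q.1.2, q.2)) = π₁.snd ⊗ₘ κ := by
  have hm : Measurable fun q : (X × X) × X => (q.1.2, q.2) := by fun_prop
  ext s hs
  rw [Measure.map_apply hm hs, Measure.compProd_apply (hm hs), Measure.compProd_apply hs,
    Measure.snd, lintegral_map (Kernel.measurable_kernel_prodMk_left hs) measurable_snd]
  rfl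

lemma prod_mem_couplings (μ ν : ProbabilityMeasure X) :
    (⟨(μ : Measure X).prod ν, inferInstance⟩ : ProbabilityMeasure (X × X)) ∈ couplings μ ν :=
  ⟨Measure.fst_prod, Measure.snd_prod⟩

lemma lintegral_fst_of_mem_couplings {μ ν : ProbabilityMeasure X} {π : ProbabilityMeasure (X × X)}
    (hπ : π ∈ couplings μ ν) {f : X → ℝ≥0∞} (hf : Measurable f) :
    ∫⁻ q, f q.1 ∂(π : Measure (X × X)) = ∫⁻ x, f x ∂(μ : Measure X) := by
  rw [← hπ.1, Measure.fst, lintegral_map hf measurable_fst]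

lemma lintegral_snd_of_mem_couplings {μ ν : ProbabilityMeasure X} {π : ProbabilityMeasure (X × X)}
    (hπ : π ∈ couplings μ ν) {f : X → ℝ≥0∞} (hf : Measurable f) :
    ∫⁻ q, f q.2 ∂(π : Measure (X × X)) = ∫⁻ x, f x ∂(ν : Measure X) := by
  rw [← hπ.2, Measure.snd, lintegral_map hf measurable_snd]

end Couplings

/-! ### Symmetry and triangle inequality of the Wasserstein distance. -/

section Wass

variable {X : Type*} [MeasurableSpace X] [PseudoEMetricSpace X]

lemma wass_le_of_mem_couplings (p : ℝ) {μ ν : ProbabilityMeasure X}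
    {π : ProbabilityMeasure (X × X)} (hπ : π ∈ couplings μ ν) :
    wass p μ ν ≤ (∫⁻ z, edist z.1 z.2 ^ p ∂(π : Measure (X × X))) ^ (1 / p) :=
  iInf₂_le π hπ

lemma exists_coupling_of_wass_lt {p : ℝ} {μ ν : ProbabilityMeasure X} {c : ℝ≥0∞}
    (h : wass p μ ν < c) :
    ∃ π ∈ couplings μ ν, (∫⁻ z, edist z.1 z.2 ^ p ∂(π : Measure (X × X))) ^ (1 / p) < c := by
  simpa only [wass, iInf_lt_iff, exists_prop] using h

variable [OpensMeasurableSpace X] [SecondCountableTopology X]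

lemma wass_comm_le (p : ℝ) (μ ν : ProbabilityMeasure X) : wass p μ ν ≤ wass p ν μ := by
  refine le_iInf₂ fun π hπ => ?_
  let π' : ProbabilityMeasure (X × X) := π.map (f := Prod.swap) measurable_swap.aemeasurable
  have hπ' : π' ∈ couplings μ ν :=
    ⟨(Measure.fst_map_swap (ρ := (π : Measure (X × X)))).trans hπ.2,
      (Measure.snd_map_swap (ρ := (π : Measure (X × X)))).trans hπ.1⟩
  refine (wass_le_of_mem_couplings p hπ').trans (le_of_eq ?_)
  have : ∫⁻ z, edist z.1 z.2 ^ p ∂(π' : Measure (X × X))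
      = ∫⁻ z, edist z.1 z.2 ^ p ∂((π : Measure (X × X)).map Prod.swap) := rfl
  rw [this, lintegral_map (by fun_prop) measurable_swap]
  simp [edist_comm]

lemma wass_comm (p : ℝ) (μ ν : ProbabilityMeasure X) : wass p μ ν = wass p ν μ :=
  (wass_comm_le p μ ν).antisymm (wass_comm_le p ν μ)

variable [StandardBorelSpace X] [Nonempty X]

lemma wass_triangle {p : ℝ} (hp : 1 ≤ p) (μ ν ρ : ProbabilityMeasure X) :
    wass p μ ρ ≤ wass p μ ν + wass p ν ρ := by
  have hp0 : 0 < p := by linarith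
  suffices h : ∀ π₁ ∈ couplings μ ν, ∀ π₂ ∈ couplings ν ρ, wass p μ ρ ≤
      (∫⁻ z, edist z.1 z.2 ^ p ∂(π₁ : Measure (X × X))) ^ (1 / p) +
      (∫⁻ z, edist z.1 z.2 ^ p ∂(π₂ : Measure (X × X))) ^ (1 / p) by
    -- Optimal couplings need not be available, so each distance is approximated within η / 2.
    refine ENNReal.le_of_forall_pos_le_add fun η hη hfin => ?_
    have hη2 : (0 : ℝ≥0∞) < η / 2 := by simpa using hη.ne'
    have h1 := ENNReal.lt_add_right (ENNReal.add_lt_top.1 hfin).1.ne hη2.ne'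
    have h2 := ENNReal.lt_add_right (ENNReal.add_lt_top.1 hfin).2.ne hη2.ne'
    obtain ⟨π₁, hπ₁, hc₁⟩ := exists_coupling_of_wass_lt h1
    obtain ⟨π₂, hπ₂, hc₂⟩ := exists_coupling_of_wass_lt h2
    refine (h π₁ hπ₁ π₂ hπ₂).trans ((add_le_add hc₁.le hc₂.le).trans (le_of_eq ?_))
    rw [add_add_add_comm, ENNReal.add_halves]
  intro π₁ hπ₁ π₂ hπ₂
  let κ := (π₂ : Measure (X × X)).condKernel
  let γ := (π₁ : Measure (X × X)) ⊗ₘ κ.comap Prod.snd measurable_snd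
  have hm12 : Measurable fun q : (X × X) × X => (q.1.2, q.2) := by fun_prop
  have hm02 : Measurable fun q : (X × X) × X => (q.1.1, q.2) := by fun_prop
  have hγ1 : γ.map Prod.fst = π₁ := fst_glue _ _
  have hγ2 : γ.map (fun q => (q.1.2, q.2)) = π₂ := by
    rw [map_glue, hπ₁.2, ← hπ₂.1]
    exact Measure.disintegrate _ _
  let π : ProbabilityMeasure (X × X) :=
    ⟨γ.map fun q => (q.1.1, q.2), Measure.isProbabilityMeasure_map hm02.aemeasurable⟩
  have hπ : π ∈ couplings μ ρ := by
    constructor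
    · rw [← hπ₁.1, ← hγ1]
      simp only [π, ProbabilityMeasure.coe_mk, Measure.fst]
      rw [Measure.map_map measurable_fst hm02, Measure.map_map measurable_fst measurable_fst]
      rfl
    · rw [← hπ₂.2, ← hγ2]
      simp only [π, ProbabilityMeasure.coe_mk, Measure.snd]
      rw [Measure.map_map measurable_snd hm02, Measure.map_map measurable_snd hm12]
      rfl
  have hd : Measurable fun z : X × X => edist z.1 z.2 ^ p := by fun_prop
  refine (wass_le_of_mem_couplings p hπ).trans ?_
  rw [← hγ1, ← hγ2]
  simp only [π, ProbabilityMeasure.coe_mk]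
  rw [lintegral_map hd hm02, lintegral_map hd hm12, lintegral_map hd measurable_fst]
  refine le_trans ?_ (ENNReal.lintegral_Lp_add_le (μ := γ) (p := p)
    (f := fun q => edist q.1.1 q.1.2) (g := fun q => edist q.1.2 q.2)
    (by fun_prop) (by fun_prop) hp)
  gcongr
  exact edist_triangle _ _ _

end Wass

/-! ### Trimmings: transport along couplings, and common trimmings. -/

section WassTrimming

variable {X : Type*} [MeasurableSpace X] [PseudoEMetricSpace X] [StandardBorelSpace X]
  [Nonempty X]

/-- A trimming of the first marginal is transported along a coupling to a trimming of the second
marginal. -/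
lemma exists_trimming_wass_le {p ε : ℝ} (hp : 0 < p) {μ ν μ' : ProbabilityMeasure X}
    (hμ' : μ' ∈ trimmings ε μ) {c : ℝ≥0∞} (hc : wass p μ ν < c) :
    ∃ ν' ∈ trimmings ε ν, wass p μ' ν' ≤ ENNReal.ofReal (1 - ε)⁻¹ ^ (1 / p) * c := by
  obtain ⟨π, hπ, hπc⟩ := exists_coupling_of_wass_lt hc
  -- Running the conditional kernel of `π` from `μ'` instead of `μ` preserves the density bound, so
  -- the new coupling is dominated by (1 - ε)⁻¹ `π`; both the trimming property and the cost bound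
  -- follow.
  let κ := (π : Measure (X × X)).condKernel
  let π' : ProbabilityMeasure (X × X) := ⟨(μ' : Measure X) ⊗ₘ κ, inferInstance⟩
  have hle : (π' : Measure (X × X)) ≤ ENNReal.ofReal (1 - ε)⁻¹ • (π : Measure (X × X)) := by
    have hdis : (μ : Measure X) ⊗ₘ κ = π := by
      rw [← hπ.1]; exact Measure.disintegrate _ _
    rw [← hdis]
    refine Measure.le_iff.2 fun s hs => ?_
    simp only [π', ProbabilityMeasure.coe_mk, Measure.smul_apply, smul_eq_mul]
    rw [Measure.compProd_apply hs, Measure.compProd_apply hs,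
      ← smul_eq_mul, ← lintegral_smul_measure]
    exact lintegral_mono' hμ' le_rfl
  let ν' : ProbabilityMeasure X := ⟨(π' : Measure (X × X)).snd, inferInstance⟩
  refine ⟨ν', ?_, ?_⟩
  · change (π' : Measure (X × X)).map Prod.snd ≤ _
    rw [← hπ.2, Measure.snd, ← Measure.map_smul]
    exact Measure.map_mono hle measurable_snd
  · have hπ' : π' ∈ couplings μ' ν' := ⟨Measure.fst_compProd _ _, rfl⟩
    refine (wass_le_of_mem_couplings p hπ').trans ?_
    calc (∫⁻ z, edist z.1 z.2 ^ p ∂(π' : Measure (X × X))) ^ (1 / p)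
        ≤ (∫⁻ z, edist z.1 z.2 ^ p ∂(ENNReal.ofReal (1 - ε)⁻¹ • (π : Measure (X × X))))
            ^ (1 / p) := by
          gcongr
      _ = ENNReal.ofReal (1 - ε)⁻¹ ^ (1 / p) *
            (∫⁻ z, edist z.1 z.2 ^ p ∂(π : Measure (X × X))) ^ (1 / p) := by
          rw [lintegral_smul_measure, smul_eq_mul, ENNReal.mul_rpow_of_nonneg _ _ (by positivity)]
      _ ≤ _ := by gcongr

end WassTrimming

section Trimmings

variable {X : Type*} [MeasurableSpace X]

/-- Two probability measures that overlap with mass at least `1 - ε` have a common `ε`-trimming. -/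
lemma exists_common_trimming {ε : ℝ} (hε : ε < 1) {μ ν : ProbabilityMeasure X}
    (h : ∀ s, MeasurableSet s →
      ENNReal.ofReal (1 - ε) ≤ (μ : Measure X) s + (ν : Measure X) sᶜ) :
    ∃ κ, κ ∈ trimmings ε μ ∧ κ ∈ trimmings ε ν := by
  obtain ⟨s, hs, h1, h2⟩ := hahn_decomposition (ν : Measure X) (μ : Measure X)
  have hε' : 0 < 1 - ε := by linarith
  -- This is the minimum of `μ` and `ν`, as `μ` ≤ `ν` on `s` and `ν` ≤ `μ` on its complement. Its
  -- mass is at least 1 - ε, so normalizing costs at most the factor (1 - ε)⁻¹.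
  let κ₀ : Measure X := (μ : Measure X).restrict s + (ν : Measure X).restrict sᶜ
  have hκ₀ : κ₀ Set.univ = (μ : Measure X) s + (ν : Measure X) sᶜ := by simp [κ₀]
  have hle : ENNReal.ofReal (1 - ε) ≤ κ₀ Set.univ := hκ₀ ▸ h s hs
  have hpos : κ₀ Set.univ ≠ 0 := fun h0 => by
    rw [h0] at hle
    exact absurd hle (by simpa using hε)
  have hfin : κ₀ Set.univ ≠ ∞ := measure_ne_top _ _
  have hinv : (κ₀ Set.univ)⁻¹ ≤ ENNReal.ofReal (1 - ε)⁻¹ := by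
    rw [ENNReal.ofReal_inv_of_pos hε']
    exact ENNReal.inv_le_inv.2 hle
  have hμ : κ₀ ≤ μ := Measure.le_iff.2 fun t ht => by
    rw [Measure.add_apply, Measure.restrict_apply ht, Measure.restrict_apply ht,
      ← measure_inter_add_sdiff t hs, Set.sdiff_eq]
    exact add_le_add le_rfl (h2 _ (ht.inter hs.compl) Set.inter_subset_right)
  have hν : κ₀ ≤ ν := Measure.le_iff.2 fun t ht => by
    rw [Measure.add_apply, Measure.restrict_apply ht, Measure.restrict_apply ht,
      ← measure_inter_add_sdiff t hs, Set.sdiff_eq]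
    exact add_le_add (h1 _ (ht.inter hs) Set.inter_subset_right) le_rfl
  refine ⟨⟨(κ₀ Set.univ)⁻¹ • κ₀, ⟨?_⟩⟩, ?_, ?_⟩
  · rw [Measure.smul_apply, smul_eq_mul, ENNReal.inv_mul_cancel hpos hfin]
  · exact (Measure.le_iff.2 fun t _ => by
      simp only [ProbabilityMeasure.coe_mk, Measure.smul_apply, smul_eq_mul]
      exact mul_le_mul' hinv (hμ t))
  · exact (Measure.le_iff.2 fun t _ => by
      simp only [ProbabilityMeasure.coe_mk, Measure.smul_apply, smul_eq_mul]
      exact mul_le_mul' hinv (hν t))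

/-- Since `μ` and `ν` have equal mass, the two Jordan parts of `μ - ν` do too, and `tvDist` is the
mass of the negative part. -/
lemma sub_le_tvDist {μ ν : ProbabilityMeasure X} {s : Set X}
    (hs : MeasurableSet s) : (ν : Measure X) s - (μ : Measure X) s ≤ tvDist μ ν := by
  set t := (μ : Measure X).toSignedMeasure - (ν : Measure X).toSignedMeasure with ht
  set j := t.toJordanDecomposition
  have hval : ∀ u, MeasurableSet u → j.posPart.real u - j.negPart.real u
      = (μ : Measure X).real u - (ν : Measure X).real u := fun u hu => by
    rw [← t.apply_eq_posPart_real_sub_negPart_real hu, ht, _root_.sub_apply,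
      Measure.toSignedMeasure_apply_measurable hu, Measure.toSignedMeasure_apply_measurable hu]
  have huniv : j.posPart.real Set.univ = j.negPart.real Set.univ := by
    have := hval _ MeasurableSet.univ
    simp only [probReal_univ, sub_self] at this
    linarith
  have hposneg : j.posPart Set.univ = j.negPart Set.univ := by
    rwa [measureReal_def, measureReal_def,
      ENNReal.toReal_eq_toReal_iff' (measure_ne_top _ _) (measure_ne_top _ _)] at huniv
  have hTV : tvDist μ ν = j.negPart Set.univ := by
    rw [tvDist, SignedMeasure.totalVariation, Measure.add_apply, hposneg, ← two_mul,
      mul_comm, ENNReal.mul_div_cancel_right two_ne_zero ENNReal.ofNat_ne_top]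
  rw [hTV, tsub_le_iff_left]
  have h := hval s hs
  have hn : j.negPart.real s ≤ j.negPart.real Set.univ := measureReal_mono (Set.subset_univ s)
  have hp : 0 ≤ j.posPart.real s := measureReal_nonneg
  have hr : (ν : Measure X).real s ≤ (μ : Measure X).real s + j.negPart.real Set.univ := by
    linarith
  rw [← ENNReal.toReal_le_toReal (measure_ne_top _ _)
    (ENNReal.add_ne_top.2 ⟨measure_ne_top _ _, measure_ne_top _ _⟩),
    ENNReal.toReal_add (measure_ne_top _ _) (measure_ne_top _ _)]
  exact hr

lemma exists_common_trimming_of_tvDist_le {ε : ℝ} (hε0 : 0 ≤ ε) (hε : ε < 1)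
    {μ ν : ProbabilityMeasure X} (h : tvDist μ ν ≤ ENNReal.ofReal ε) :
    ∃ κ, κ ∈ trimmings ε μ ∧ κ ∈ trimmings ε ν := by
  refine exists_common_trimming hε fun s hs => ?_
  have h1 : (ν : Measure X) s ≤ ENNReal.ofReal ε + (μ : Measure X) s :=
    tsub_le_iff_right.1 ((sub_le_tvDist hs).trans h)
  have h2 : (ν : Measure X) s + (ν : Measure X) sᶜ = 1 := prob_add_prob_compl hs
  rw [ENNReal.ofReal_sub _ hε0, ENNReal.ofReal_one, tsub_le_iff_left, ← h2, ← add_assoc]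
  gcongr

/-- The overlap is controlled by μ₁(s) + μ₂(sᶜ) = 2 - μ₁(sᶜ) - μ₂(s) ≥ 2 - (1 - ε)⁻¹ = 1 - ε/(1 -
ε). The condition ε < 1/2 keeps the new trimming level below 1. -/
lemma exists_common_trimming_of_mem_trimmings {ε : ℝ} (hε : ε < 1 / 2)
    {μ μ₁ μ₂ : ProbabilityMeasure X} (h₁ : μ₁ ∈ trimmings ε μ) (h₂ : μ₂ ∈ trimmings ε μ) :
    ∃ κ, κ ∈ trimmings (ε / (1 - ε)) μ₁ ∧ κ ∈ trimmings (ε / (1 - ε)) μ₂ := by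
  have h1ε : 0 < 1 - ε := by linarith
  have hc : 0 ≤ (1 - ε)⁻¹ := by positivity
  have key : ∀ {ν : ProbabilityMeasure X}, ν ∈ trimmings ε μ → ∀ s,
      (ν : Measure X).real s ≤ (1 - ε)⁻¹ * (μ : Measure X).real s := fun hν s => by
    have := ENNReal.toReal_mono
      (ENNReal.mul_ne_top ENNReal.ofReal_ne_top (measure_ne_top _ _)) (hν s)
    simpa [measureReal_def, ENNReal.toReal_mul, ENNReal.toReal_ofReal hc] using this
  refine exists_common_trimming ((div_lt_one h1ε).2 (by linarith)) fun s hs => ?_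
  have e1 := key h₁ sᶜ
  have e2 := key h₂ s
  have a1 := probReal_add_probReal_compl (μ := (μ₁ : Measure X)) hs
  have a2 := probReal_add_probReal_compl (μ := (μ₂ : Measure X)) hs
  have a3 := probReal_add_probReal_compl (μ := (μ : Measure X)) hs
  have e3 : (1 - ε)⁻¹ * (μ : Measure X).real s + (1 - ε)⁻¹ * (μ : Measure X).real sᶜ
      = (1 - ε)⁻¹ := by rw [← mul_add, a3, mul_one]
  have e4 : 1 - ε / (1 - ε) = 2 - (1 - ε)⁻¹ := by field_simp; ring
  refine ENNReal.ofReal_le_of_le_toReal ?_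
  rw [ENNReal.toReal_add (measure_ne_top _ _) (measure_ne_top _ _), e4]
  change _ ≤ (μ₁ : Measure X).real s + (μ₂ : Measure X).real sᶜ
  linarith

end Trimmings

/-! ### Resilience from second moments. -/

section Moments

lemma ofReal_sq_rpow_half {t : ℝ} (ht : 0 ≤ t) :
    ENNReal.ofReal (t ^ 2) ^ (1 / 2 : ℝ) = ENNReal.ofReal t := by
  rw [ENNReal.ofReal_rpow_of_nonneg (by positivity) (by norm_num), ← Real.sqrt_eq_rpow,
    Real.sqrt_sq ht]

variable {X : Type*} [MeasurableSpace X]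

lemma lintegral_sq_le_of_mem_trimmings {ε s : ℝ} (hε : ε < 1) {ν ν' : ProbabilityMeasure X}
    (h : ν' ∈ trimmings ε ν) {φ : X → ℝ≥0∞}
    (hs : ∫⁻ x, φ x ^ 2 ∂(ν : Measure X) ≤ ENNReal.ofReal (s ^ 2)) :
    ∫⁻ x, φ x ^ 2 ∂(ν' : Measure X) ≤ ENNReal.ofReal ((1 - ε)⁻¹ * s ^ 2) := by
  have hc : 0 ≤ (1 - ε)⁻¹ := inv_nonneg.2 (by linarith)
  calc ∫⁻ x, φ x ^ 2 ∂(ν' : Measure X)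
      ≤ ∫⁻ x, φ x ^ 2 ∂(ENNReal.ofReal (1 - ε)⁻¹ • (ν : Measure X)) := lintegral_mono' h le_rfl
    _ ≤ _ := by
      rw [lintegral_smul_measure, smul_eq_mul, ENNReal.ofReal_mul hc]
      gcongr

lemma lintegral_le_of_lintegral_sq_le {m : Measure X} {φ : X → ℝ≥0∞} (hφ : Measurable φ)
    {a b : ℝ} (ha : 0 ≤ a) (hb : 0 ≤ b) (hm : m Set.univ ≤ ENNReal.ofReal (a ^ 2))
    (h : ∫⁻ x, φ x ^ 2 ∂m ≤ ENNReal.ofReal (b ^ 2)) :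
    ∫⁻ x, φ x ∂m ≤ ENNReal.ofReal (b * a) := by
  have h1 := ENNReal.lintegral_mul_le_Lp_mul_Lq m Real.HolderConjugate.two_two
    hφ.aemeasurable (g := 1) aemeasurable_const
  simp only [Pi.mul_apply, Pi.one_apply, mul_one, ENNReal.rpow_ofNat, one_pow,
    lintegral_one] at h1
  refine h1.trans ?_
  rw [ENNReal.ofReal_mul hb, ← ofReal_sq_rpow_half ha, ← ofReal_sq_rpow_half hb]
  gcongr

end Moments

section WassTwo

variable {X : Type*} [MeasurableSpace X] [PseudoEMetricSpace X]

/-- For p = 2 no power of ε is to be gained, so the independent coupling and Minkowski suffice. The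
function `φ` stands for the distance to a centre, which may lie outside the space. -/
lemma wass_two_le_of_mem_trimmings {ε : ℝ} (hε : ε < 1)
    {ν ν' : ProbabilityMeasure X} (h : ν' ∈ trimmings ε ν) {φ : X → ℝ≥0∞} (hφ : Measurable φ)
    (hd : ∀ x y, edist x y ≤ φ x + φ y) {s : ℝ} (hs0 : 0 ≤ s)
    (hs : ∫⁻ x, φ x ^ 2 ∂(ν : Measure X) ≤ ENNReal.ofReal (s ^ 2)) :
    wass 2 ν' ν ≤ ENNReal.ofReal (s * √(1 - ε)⁻¹ + s) := by
  have hc : 0 ≤ (1 - ε)⁻¹ := inv_nonneg.2 (by linarith)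
  have hπ := prod_mem_couplings ν' ν
  refine (wass_le_of_mem_couplings 2 hπ).trans ?_
  set π : ProbabilityMeasure (X × X) := ⟨(ν' : Measure X).prod ν, inferInstance⟩
  calc (∫⁻ z, edist z.1 z.2 ^ (2 : ℝ) ∂(π : Measure (X × X))) ^ (1 / 2 : ℝ)
      ≤ (∫⁻ z, ((fun z : X × X => φ z.1) + fun z : X × X => φ z.2) z ^ (2 : ℝ)
          ∂(π : Measure (X × X))) ^ (1 / 2 : ℝ) := by
        gcongr; exact hd _ _
    _ ≤ (∫⁻ z, φ z.1 ^ (2 : ℝ) ∂(π : Measure (X × X))) ^ (1 / 2 : ℝ)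
        + (∫⁻ z, φ z.2 ^ (2 : ℝ) ∂(π : Measure (X × X))) ^ (1 / 2 : ℝ) :=
        ENNReal.lintegral_Lp_add_le (by fun_prop) (by fun_prop) (by norm_num)
    _ ≤ ENNReal.ofReal (s * √(1 - ε)⁻¹) + ENNReal.ofReal s := by
        simp only [ENNReal.rpow_ofNat]
        rw [lintegral_fst_of_mem_couplings hπ (f := fun x => φ x ^ 2) (by fun_prop),
          lintegral_snd_of_mem_couplings hπ (f := fun x => φ x ^ 2) (by fun_prop),
          ← ofReal_sq_rpow_half hs0, ← ofReal_sq_rpow_half (t := s * √(1 - ε)⁻¹) (by positivity), mul_pow, Real.sq_sqrt hc,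
          mul_comm (s ^ 2)]
        gcongr
        exact lintegral_sq_le_of_mem_trimmings hε h hs
    _ = _ := (ENNReal.ofReal_add (by positivity) hs0).symm

/-- The threshold 49/51 is ε/(1 - ε) at ε = 0.49. -/
lemma sqrt_inv_one_sub_le {ε : ℝ} (hε : ε ≤ 49 / 51) : √(1 - ε)⁻¹ ≤ 6 := by
  rw [Real.sqrt_le_left (by norm_num)]
  exact (inv_anti₀ (by norm_num) (by linarith : (2 / 51 : ℝ) ≤ 1 - ε)).trans (by norm_num)

lemma wass_two_le_seven_mul {ε : ℝ} (hε : ε ≤ 49 / 51)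
    {ν ν' : ProbabilityMeasure X} (h : ν' ∈ trimmings ε ν) {φ : X → ℝ≥0∞} (hφ : Measurable φ)
    (hd : ∀ x y, edist x y ≤ φ x + φ y) {s : ℝ} (hs0 : 0 ≤ s)
    (hs : ∫⁻ x, φ x ^ 2 ∂(ν : Measure X) ≤ ENNReal.ofReal (s ^ 2)) :
    wass 2 ν' ν ≤ ENNReal.ofReal (7 * s) := by
  refine (wass_two_le_of_mem_trimmings (by linarith) h hφ hd hs0 hs).trans
    (ENNReal.ofReal_le_ofReal ?_)
  have h2 : s * √(1 - ε)⁻¹ ≤ s * 6 := by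
    gcongr; exact sqrt_inv_one_sub_le hε
  linarith

end WassTwo

section Resilience

variable {X : Type*} [MeasurableSpace X] [PseudoEMetricSpace X] [OpensMeasurableSpace X]
  [SecondCountableTopology X]

lemma wass_one_le_of_mem_trimmings {ε : ℝ} (hε0 : 0 ≤ ε) (hε : ε < 1)
    {ν ν' : ProbabilityMeasure X} (h : ν' ∈ trimmings ε ν) {φ : X → ℝ≥0∞} (hφ : Measurable φ)
    (hd : ∀ x y, edist x y ≤ φ x + φ y) {s : ℝ} (hs0 : 0 ≤ s)
    (hs : ∫⁻ x, φ x ^ 2 ∂(ν : Measure X) ≤ ENNReal.ofReal (s ^ 2)) :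
    wass 1 ν' ν ≤ ENNReal.ofReal (ε * (s * √(1 - ε)⁻¹) + s * √ε) := by
  have h1ε : 0 < 1 - ε := by linarith
  have hc : 0 ≤ (1 - ε)⁻¹ := by positivity
  set a : ℝ≥0∞ := ENNReal.ofReal (1 - ε) with ha
  have hainv : a * ENNReal.ofReal (1 - ε)⁻¹ = 1 := by
    rw [ha, ← ENNReal.ofReal_mul h1ε.le, mul_inv_cancel₀ h1ε.ne', ENNReal.ofReal_one]
  have haε : a + ENNReal.ofReal ε = 1 := by
    rw [ha, ← ENNReal.ofReal_add h1ε.le hε0]; simp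
  have hfinm : IsFiniteMeasure (a • (ν' : Measure X)) :=
    Measure.smul_finite _ ENNReal.ofReal_ne_top
  have hle : a • (ν' : Measure X) ≤ ν := Measure.le_iff.2 fun t _ => by
    calc a * (ν' : Measure X) t ≤ a * (ENNReal.ofReal (1 - ε)⁻¹ * (ν : Measure X) t) := by
          gcongr; exact h t
      _ = (ν : Measure X) t := by rw [← mul_assoc, hainv, one_mul]
  -- Since (1 - ε)`ν'` ≤ `ν`, that mass can stay put. Only the remainder `r`, of mass ε, is coupled
  -- independently with `ν'`, and Cauchy-Schwarz on `r` yields the factor √ε.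
  let r : Measure X := ν - a • (ν' : Measure X)
  have hr : r + a • (ν' : Measure X) = ν := Measure.sub_add_cancel_of_le hle
  have hrle : r ≤ ν := Measure.sub_le
  have hrfin : IsFiniteMeasure r := isFiniteMeasure_of_le _ hrle
  have hruniv : r Set.univ = ENNReal.ofReal ε := by
    have h2 := congrArg (fun m : Measure X => m Set.univ) hr
    simp only [Measure.add_apply, Measure.smul_apply, measure_univ, smul_eq_mul, mul_one] at h2
    rw [← haε, add_comm] at h2
    exact (ENNReal.add_right_inj ENNReal.ofReal_ne_top).1 h2
  let D : Measure (X × X) := (ν' : Measure X).map fun x => (x, x)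
  have hdiag : Measurable fun x : X => (x, x) := by fun_prop
  let P : Measure (X × X) := a • D + (ν' : Measure X).prod r
  have hfst : P.fst = ν' := by
    have : D.fst = ν' := by
      simp only [D, Measure.fst]
      rw [Measure.map_map measurable_fst hdiag]
      exact Measure.map_id
    rw [Measure.fst, Measure.map_add _ _ measurable_fst, Measure.map_smul]
    change a • D.fst + ((ν' : Measure X).prod r).fst = _
    rw [this, Measure.fst, Measure.map_fst_prod, hruniv, ← add_smul, haε, one_smul]
  have hsnd : P.snd = ν := by
    have : D.snd = ν' := by
      simp only [D, Measure.snd]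
      rw [Measure.map_map measurable_snd hdiag]
      exact Measure.map_id
    rw [Measure.snd, Measure.map_add _ _ measurable_snd, Measure.map_smul]
    change a • D.snd + ((ν' : Measure X).prod r).snd = _
    rw [this, Measure.snd, Measure.map_snd_prod, measure_univ, one_smul, add_comm, hr]
  let π : ProbabilityMeasure (X × X) := ⟨P, ⟨by
    rw [← Measure.fst_univ, hfst, measure_univ]⟩⟩
  have hπ : π ∈ couplings ν' ν := ⟨hfst, hsnd⟩
  have hν' : ∫⁻ x, φ x ∂(ν' : Measure X) ≤ ENNReal.ofReal (s * √(1 - ε)⁻¹) := by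
    have := lintegral_le_of_lintegral_sq_le (m := (ν' : Measure X)) hφ zero_le_one
      (b := s * √(1 - ε)⁻¹) (by positivity) (by simp) (by
        rw [mul_pow, Real.sq_sqrt hc, mul_comm]
        exact lintegral_sq_le_of_mem_trimmings hε h hs)
    rwa [mul_one] at this
  have hrφ : ∫⁻ x, φ x ∂r ≤ ENNReal.ofReal (s * √ε) :=
    lintegral_le_of_lintegral_sq_le hφ (Real.sqrt_nonneg _) hs0
      (by rw [Real.sq_sqrt hε0, hruniv]) ((lintegral_mono' hrle le_rfl).trans hs)
  refine (wass_le_of_mem_couplings 1 hπ).trans ?_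
  simp only [ENNReal.rpow_one, div_one]
  have hedist : Measurable fun z : X × X => edist z.1 z.2 := by fun_prop
  calc ∫⁻ z, edist z.1 z.2 ∂P = ∫⁻ z, edist z.1 z.2 ∂((ν' : Measure X).prod r) := by
        rw [lintegral_add_measure, lintegral_smul_measure, lintegral_map hedist hdiag]
        simp
    _ ≤ ∫⁻ z, (φ z.1 + φ z.2) ∂((ν' : Measure X).prod r) := lintegral_mono fun z => hd _ _
    _ = (∫⁻ z, φ z ∂(ν' : Measure X)) * ENNReal.ofReal ε + ∫⁻ z, φ z ∂r := by
        rw [lintegral_prod _ (by fun_prop)]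
        simp only
        simp_rw [lintegral_add_left measurable_const, lintegral_const, hruniv]
        rw [lintegral_add_right _ measurable_const, lintegral_mul_const _ hφ, lintegral_const,
          measure_univ, mul_one]
    _ ≤ ENNReal.ofReal (s * √(1 - ε)⁻¹) * ENNReal.ofReal ε + ENNReal.ofReal (s * √ε) := by
        gcongr
    _ = _ := by
        rw [← ENNReal.ofReal_mul (by positivity), ← ENNReal.ofReal_add (by positivity)
          (by positivity), mul_comm ε]

lemma wass_one_le_seven_mul {ε : ℝ} (hε0 : 0 ≤ ε) (hε : ε ≤ 49 / 51)
    {ν ν' : ProbabilityMeasure X} (h : ν' ∈ trimmings ε ν) {φ : X → ℝ≥0∞} (hφ : Measurable φ)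
    (hd : ∀ x y, edist x y ≤ φ x + φ y) {s : ℝ} (hs0 : 0 ≤ s)
    (hs : ∫⁻ x, φ x ^ 2 ∂(ν : Measure X) ≤ ENNReal.ofReal (s ^ 2)) :
    wass 1 ν' ν ≤ ENNReal.ofReal (7 * (√ε * s)) := by
  refine (wass_one_le_of_mem_trimmings hε0 (by linarith) h hφ hd hs0 hs).trans
    (ENNReal.ofReal_le_ofReal ?_)
  have h1 : ε ≤ √ε := Real.le_sqrt_of_sq_le (by nlinarith)
  have h2 : ε * (s * √(1 - ε)⁻¹) ≤ √ε * (s * 6) := by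
    gcongr; exact sqrt_inv_one_sub_le hε
  linarith

end Resilience

section Trimming

variable {X : Type*} [MeasurableSpace X] [PseudoEMetricSpace X]

lemma exists_trimming_of_oneSidedRobustWass_lt {p ε : ℝ} {μ ν : ProbabilityMeasure X} {c : ℝ≥0∞}
    (h : oneSidedRobustWass p ε μ ν < c) : ∃ μ' ∈ trimmings ε μ, wass p μ' ν < c := by
  simpa only [oneSidedRobustWass, iInf_lt_iff, exists_prop] using h

end Trimming

/-! ### Feasibility of the clean law and diameter of the robust ball. -/

section Robust

variable {X : Type*} [MeasurableSpace X] [PseudoEMetricSpace X] [OpensMeasurableSpace X]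
  [SecondCountableTopology X] [StandardBorelSpace X] [Nonempty X]

/-- The clean distribution is feasible for the one-sided robust ball. -/
lemma oneSidedRobustWass_le_of_robustWass_le {p ε : ℝ} (hp : 1 ≤ p) (hε0 : 0 ≤ ε) (hε : ε < 1)
    {μt μh μ : ProbabilityMeasure X} {a b T : ℝ≥0∞} (ha : a ≠ ∞)
    (h₁ : robustWass p ε μt μh ≤ a) (h₂ : wass p μh μ ≤ b) (hb : b ≠ ∞)
    (hT : ∀ μ' ∈ trimmings ε μ, wass p μ' μ ≤ T) :
    oneSidedRobustWass p ε μt μ ≤ ENNReal.ofReal (1 - ε)⁻¹ ^ (1 / p) * (a + b) + T := by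
  set k := ENNReal.ofReal (1 - ε)⁻¹ ^ (1 / p) with hk
  have hkfin : k ≠ ∞ := ENNReal.rpow_ne_top_of_nonneg (by positivity) ENNReal.ofReal_ne_top
  -- The infima need not be attained, so the bound is proved for every larger radius `c`, which then
  -- decreases to `a + b`.
  have key : ∀ c, a + b < c → oneSidedRobustWass p ε μt μ ≤ k * c + T := by
    intro c hc
    obtain ⟨a', haa', ha'c⟩ : ∃ a', a < a' ∧ a' + b < c := by
      obtain ⟨a', h1, h2⟩ := exists_between (lt_tsub_iff_right.2 hc)
      exact ⟨a', h1, lt_tsub_iff_right.1 h2⟩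
    obtain ⟨μ', hTV, hw⟩ : ∃ μ', tvDist μ' μt ≤ ENNReal.ofReal ε ∧ wass p μ' μh < a' := by
      simpa only [robustWass, iInf_lt_iff, exists_prop] using h₁.trans_lt haa'
    obtain ⟨κ, hκ', hκ⟩ := exists_common_trimming_of_tvDist_le hε0 hε hTV
    have hw2 : wass p μ' μ < c :=
      (wass_triangle hp μ' μh μ).trans_lt ((add_le_add hw.le h₂).trans_lt ha'c)
    obtain ⟨μ'', hμ'', hle⟩ := exists_trimming_wass_le (by linarith) hκ' hw2
    exact (iInf₂_le κ hκ).trans ((wass_triangle hp κ μ'' μ).trans (add_le_add hle (hT _ hμ'')))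
  have hab : a + b ≠ ∞ := ENNReal.add_ne_top.2 ⟨ha, hb⟩
  refine ge_of_tendsto (f := fun η : ℝ≥0∞ => k * (a + b + η) + T) (x := nhdsWithin 0 (Set.Ioi 0))
    ?_ ?_
  · refine tendsto_nhdsWithin_of_tendsto_nhds ?_
    have : Continuous fun η : ℝ≥0∞ => k * (a + b + η) + T :=
      (ENNReal.continuous_const_mul hkfin |>.comp (continuous_const.add continuous_id)).add
        continuous_const
    simpa using this.tendsto 0
  · filter_upwards [self_mem_nhdsWithin] with η hη
    exact key _ (ENNReal.lt_add_right hab (ne_of_gt hη))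

/-- Two resilient distributions in the same one-sided robust ball are close. -/
lemma wass_le_of_oneSidedRobustWass_le {p ε : ℝ} (hp : 1 ≤ p) (hε : ε < 1 / 2)
    {μt μ ν : ProbabilityMeasure X} {ρ T : ℝ≥0∞} (hρ : ρ ≠ ∞)
    (hμ : oneSidedRobustWass p ε μt μ ≤ ρ) (hν : oneSidedRobustWass p ε μt ν ≤ ρ)
    (hTμ : ∀ μ' ∈ trimmings (ε / (1 - ε)) μ, wass p μ' μ ≤ T)
    (hTν : ∀ ν' ∈ trimmings (ε / (1 - ε)) ν, wass p ν' ν ≤ T) :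
    wass p μ ν ≤ 2 * (ENNReal.ofReal (1 - ε / (1 - ε))⁻¹ ^ (1 / p) * ρ + T) := by
  set k := ENNReal.ofReal (1 - ε / (1 - ε))⁻¹ ^ (1 / p) with hk
  have hp0 : 0 < p := by linarith
  have hkfin : k ≠ ∞ := ENNReal.rpow_ne_top_of_nonneg (by positivity) ENNReal.ofReal_ne_top
  have key : ∀ c, ρ < c → wass p μ ν ≤ 2 * (k * c + T) := by
    intro c hc
    obtain ⟨μ₁, hμ₁, hw₁⟩ := exists_trimming_of_oneSidedRobustWass_lt (hμ.trans_lt hc)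
    obtain ⟨μ₂, hμ₂, hw₂⟩ := exists_trimming_of_oneSidedRobustWass_lt (hν.trans_lt hc)
    obtain ⟨κ, hκ₁, hκ₂⟩ := exists_common_trimming_of_mem_trimmings hε hμ₁ hμ₂
    obtain ⟨μ', hμ', hle⟩ := exists_trimming_wass_le hp0 hκ₁ hw₁
    obtain ⟨ν', hν', hle'⟩ := exists_trimming_wass_le hp0 hκ₂ hw₂
    have h1 : wass p κ μ ≤ k * c + T :=
      (wass_triangle hp κ μ' μ).trans (add_le_add hle (hTμ _ hμ'))
    have h2 : wass p κ ν ≤ k * c + T :=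
      (wass_triangle hp κ ν' ν).trans (add_le_add hle' (hTν _ hν'))
    rw [two_mul]
    exact (wass_triangle hp μ κ ν).trans (add_le_add (wass_comm p μ κ ▸ h1) h2)
  refine ge_of_tendsto (f := fun η : ℝ≥0∞ => 2 * (k * (ρ + η) + T))
    (x := nhdsWithin 0 (Set.Ioi 0)) ?_ ?_
  · refine tendsto_nhdsWithin_of_tendsto_nhds ?_
    have : Continuous fun η : ℝ≥0∞ => 2 * (k * (ρ + η) + T) :=
      ENNReal.continuous_const_mul ENNReal.ofNat_ne_top |>.comp
        ((ENNReal.continuous_const_mul hkfin |>.comp (continuous_const.add continuous_id)).add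
          continuous_const)
    simpa using this.tendsto 0
  · filter_upwards [self_mem_nhdsWithin] with η hη
    exact key _ (ENNReal.lt_add_right hρ (ne_of_gt hη))

end Robust

/-! ### Extended expectations and the minimax comparison. -/

section Expectation

variable {X : Type*} [MeasurableSpace X]

lemma expect_eq_integral {ν : ProbabilityMeasure X} {f : X → ℝ}
    (hf : Integrable f (ν : Measure X)) : expect ν f = ((∫ x, f x ∂(ν : Measure X) : ℝ) : EReal) := by
  rw [integral_eq_lintegral_pos_part_sub_lintegral_neg_part hf, EReal.coe_sub,
    EReal.coe_ennreal_toReal hf.lintegral_lt_top.ne,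
    EReal.coe_ennreal_toReal (x := ∫⁻ x, ENNReal.ofReal (-f x) ∂(ν : Measure X))
      hf.neg.lintegral_lt_top.ne]
  rfl

/-- With a finite positive part, an infinite negative part would force the expectation to be -∞.
This gives integrability of the learned loss, which is only bounded from above by assumption. -/
lemma integrable_of_le_expect {ν : ProbabilityMeasure X} {f : X → ℝ} (hf : Measurable f)
    (hpos : ∫⁻ x, ENNReal.ofReal (f x) ∂(ν : Measure X) ≠ ∞) {r : ℝ}
    (hr : (r : EReal) ≤ expect ν f) : Integrable f (ν : Measure X) := by
  have hneg : ∫⁻ x, ENNReal.ofReal (-f x) ∂(ν : Measure X) ≠ ∞ := by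
    intro h
    rw [expect, h, EReal.coe_ennreal_top, EReal.sub_top] at hr
    · exact absurd hr (by simp)
  refine ⟨hf.aestronglyMeasurable, ?_⟩
  rw [hasFiniteIntegral_iff_norm]
  calc ∫⁻ x, ENNReal.ofReal ‖f x‖ ∂(ν : Measure X)
      ≤ ∫⁻ x, (ENNReal.ofReal (f x) + ENNReal.ofReal (-f x)) ∂(ν : Measure X) := by
        refine lintegral_mono fun x => ?_
        rcases le_total 0 (f x) with h | h
        · rw [Real.norm_of_nonneg h]; exact le_self_add
        · rw [Real.norm_of_nonpos h]; exact le_add_self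
    _ < ∞ := by
        rw [lintegral_add_left (by fun_prop)]
        exact ENNReal.add_lt_top.2 ⟨hpos.lt_top, hneg.lt_top⟩

lemma integral_sub_le_of_mem_couplings {μ ν : ProbabilityMeasure X}
    {π : ProbabilityMeasure (X × X)} (hπ : π ∈ couplings μ ν) {f : X → ℝ} {h : X × X → ℝ}
    (hμ : Integrable f (μ : Measure X)) (hν : Integrable f (ν : Measure X))
    (hh : Integrable h (π : Measure (X × X))) (hle : ∀ q, f q.2 - f q.1 ≤ h q) :
    (∫ x, f x ∂(ν : Measure X)) - ∫ x, f x ∂(μ : Measure X)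
      ≤ ∫ q, h q ∂(π : Measure (X × X)) := by
  have m1 : MeasurePreserving Prod.fst (π : Measure (X × X)) μ := ⟨measurable_fst, hπ.1⟩
  have m2 : MeasurePreserving Prod.snd (π : Measure (X × X)) ν := ⟨measurable_snd, hπ.2⟩
  have i1 := m1.integrable_comp_of_integrable hμ
  have i2 := m2.integrable_comp_of_integrable hν
  have e1 : ∫ x, f x ∂(μ : Measure X) = ∫ q, f q.1 ∂(π : Measure (X × X)) := by
    rw [← m1.map_eq, integral_map measurable_fst.aemeasurable (by rw [m1.map_eq]; exact hμ.1)]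
  have e2 : ∫ x, f x ∂(ν : Measure X) = ∫ q, f q.2 ∂(π : Measure (X × X)) := by
    rw [← m2.map_eq, integral_map measurable_snd.aemeasurable (by rw [m2.map_eq]; exact hν.1)]
  rw [e1, e2]
  exact (integral_sub i2 i1).symm.trans_le (integral_mono (i2.sub i1) hh hle)

variable [PseudoEMetricSpace X]

/-- A uniform bound on the excess risk of the optimal loss over the feasible set bounds the excess
risk of the learned loss. -/
lemma integrable_and_integral_sub_le {p ε σ : ℝ} {ρ : ℝ≥0∞} {z₀ : X} {μt μ : ProbabilityMeasure X}
    {fhat fstar : X → ℝ} {b : ℝ}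
    (hμ : μ ∈ secondMomentClass σ z₀) (hμρ : oneSidedRobustWass p ε μt μ ≤ ρ)
    (hmeas : Measurable fhat) (hpos : ∫⁻ x, ENNReal.ofReal (fhat x) ∂(μ : Measure X) ≠ ∞)
    (hint : ∀ ν ∈ secondMomentClass σ z₀, Integrable fstar (ν : Measure X))
    (hb : ∀ ν ∈ secondMomentClass σ z₀, oneSidedRobustWass p ε μt ν ≤ ρ →
      (∫ x, fstar x ∂(ν : Measure X)) - ∫ x, fstar x ∂(μ : Measure X) ≤ b)
    (hhat : worstRisk p ε σ ρ z₀ μt fhat ≤ worstRisk p ε σ ρ z₀ μt fstar)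
    (hstar : expect μ fstar ≤ expect μ fhat) :
    Integrable fhat (μ : Measure X) ∧ Integrable fstar (μ : Measure X) ∧
      (∫ x, fhat x ∂(μ : Measure X)) - ∫ x, fstar x ∂(μ : Measure X) ≤ b := by
  have hi := hint μ hμ
  rw [expect_eq_integral hi] at hstar
  have hihat := integrable_of_le_expect hmeas hpos hstar
  refine ⟨hihat, hi, ?_⟩
  have h1 : expect μ fhat ≤ worstRisk p ε σ ρ z₀ μt fhat :=
    le_iSup₂_of_le (f := fun ν _ => expect ν fhat) μ ⟨hμ, hμρ⟩ le_rfl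
  have h2 : worstRisk p ε σ ρ z₀ μt fstar
      ≤ ((b + ∫ x, fstar x ∂(μ : Measure X) : ℝ) : EReal) := by
    refine iSup₂_le fun ν hν => ?_
    rw [expect_eq_integral (hint ν hν.1), EReal.coe_le_coe_iff]
    linarith [hb ν hν.1 hν.2]
  have h3 := h1.trans (hhat.trans h2)
  rw [expect_eq_integral hihat, EReal.coe_le_coe_iff] at h3
  linarith

end Expectation

/-! ### From Wasserstein bounds to differences of expectations. -/

section Distance

variable {X : Type*} [MeasurableSpace X] [PseudoMetricSpace X] [OpensMeasurableSpace X]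
  [SecondCountableTopology X]

lemma integrable_dist_pow {π : Measure (X × X)} {n : ℕ} {c : ℝ} (hc : 0 ≤ c)
    (h : ∫⁻ q, edist q.1 q.2 ^ n ∂π ≤ ENNReal.ofReal c) :
    Integrable (fun q : X × X => dist q.1 q.2 ^ n) π ∧ ∫ q, dist q.1 q.2 ^ n ∂π ≤ c := by
  have he : ∀ q : X × X, edist q.1 q.2 ^ n = ENNReal.ofReal (dist q.1 q.2 ^ n) := fun q => by
    rw [edist_dist, ENNReal.ofReal_pow dist_nonneg]
  simp only [he] at h
  have hm : AEStronglyMeasurable (fun q : X × X => dist q.1 q.2 ^ n) π :=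
    Measurable.aestronglyMeasurable (by fun_prop)
  have h0 : 0 ≤ᵐ[π] fun q : X × X => dist q.1 q.2 ^ n :=
    Filter.Eventually.of_forall fun q => pow_nonneg dist_nonneg n
  refine ⟨⟨hm, ?_⟩, ?_⟩
  · rw [hasFiniteIntegral_iff_ofReal h0]
    exact h.trans_lt ENNReal.ofReal_lt_top
  · rw [integral_eq_lintegral_of_nonneg_ae h0 hm]
    exact ENNReal.toReal_le_of_le_ofReal hc h

lemma integral_sub_le_of_wass_one_le {μ ν : ProbabilityMeasure X} {f : X → ℝ} {K : ℝ≥0}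
    (hf : LipschitzWith K f) (hμ : Integrable f (μ : Measure X))
    (hν : Integrable f (ν : Measure X)) {D : ℝ} (hD : 0 ≤ D)
    (h : wass 1 μ ν ≤ ENNReal.ofReal D) :
    (∫ x, f x ∂(ν : Measure X)) - ∫ x, f x ∂(μ : Measure X) ≤ K * D := by
  refine ge_of_tendsto (x := nhdsWithin D (Set.Ioi D)) (f := fun t : ℝ => K * t)
    ((continuous_const_mul (K : ℝ)).tendsto D |>.mono_left nhdsWithin_le_nhds) ?_
  filter_upwards [self_mem_nhdsWithin] with t (ht : D < t)
  obtain ⟨π, hπ, hlt⟩ := exists_coupling_of_wass_lt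
    (h.trans_lt ((ENNReal.ofReal_lt_ofReal_iff (hD.trans_lt ht)).2 ht))
  simp only [ENNReal.rpow_one, div_one] at hlt
  obtain ⟨hi, hle⟩ := integrable_dist_pow (n := 1) (hD.trans ht.le) (by simpa using hlt.le)
  simp only [pow_one] at hi hle
  refine (integral_sub_le_of_mem_couplings hπ hμ hν (hi.const_mul (K : ℝ)) fun q => ?_).trans ?_
  · rw [dist_comm]
    exact (le_abs_self _).trans (hf.dist_le_mul q.2 q.1)
  · rw [integral_const_mul]
    gcongr

lemma integral_sub_le_of_wass_two_le {μ ν : ProbabilityMeasure X} {f G : X → ℝ} {α : ℝ≥0}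
    (hG : MemLp G 2 (μ : Measure X)) (hG0 : ∀ x, 0 ≤ G x)
    (hf : ∀ x y, f y - f x ≤ G x * dist x y + α * dist x y ^ 2)
    (hμ : Integrable f (μ : Measure X)) (hν : Integrable f (ν : Measure X)) {D : ℝ} (hD : 0 ≤ D)
    (h : wass 2 μ ν ≤ ENNReal.ofReal D) :
    (∫ x, f x ∂(ν : Measure X)) - ∫ x, f x ∂(μ : Measure X)
      ≤ √(∫ x, G x ^ 2 ∂(μ : Measure X)) * D + α * D ^ 2 := by
  set S := √(∫ x, G x ^ 2 ∂(μ : Measure X)) with hS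
  refine ge_of_tendsto (x := nhdsWithin D (Set.Ioi D)) (f := fun t : ℝ => S * t + α * t ^ 2)
    ((by fun_prop : Continuous fun t : ℝ => S * t + α * t ^ 2).tendsto D
      |>.mono_left nhdsWithin_le_nhds) ?_
  filter_upwards [self_mem_nhdsWithin] with t (ht : D < t)
  have ht0 : 0 ≤ t := hD.trans ht.le
  obtain ⟨π, hπ, hlt⟩ := exists_coupling_of_wass_lt
    (h.trans_lt ((ENNReal.ofReal_lt_ofReal_iff (hD.trans_lt ht)).2 ht))
  have hlt2 : ∫⁻ q, edist q.1 q.2 ^ 2 ∂(π : Measure (X × X)) ≤ ENNReal.ofReal (t ^ 2) := by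
    rw [← ofReal_sq_rpow_half ht0] at hlt
    simp only [ENNReal.rpow_ofNat] at hlt
    exact ((ENNReal.rpow_lt_rpow_iff (by norm_num)).1 hlt).le
  obtain ⟨hi, hle⟩ := integrable_dist_pow (n := 2) (sq_nonneg t) hlt2
  have m1 : MeasurePreserving Prod.fst (π : Measure (X × X)) μ := ⟨measurable_fst, hπ.1⟩
  have hG' : MemLp (fun q : X × X => G q.1) 2 (π : Measure (X × X)) :=
    hG.comp_measurePreserving m1
  have hdm : AEStronglyMeasurable (fun q : X × X => dist q.1 q.2) (π : Measure (X × X)) :=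
    Measurable.aestronglyMeasurable (by fun_prop)
  have hd' : MemLp (fun q : X × X => dist q.1 q.2) 2 (π : Measure (X × X)) :=
    (memLp_two_iff_integrable_sq hdm).2 hi
  have hprod : Integrable (fun q : X × X => G q.1 * dist q.1 q.2) (π : Measure (X × X)) :=
    hG'.integrable_mul hd'
  -- `G` is evaluated at the `μ`-marginal, so Cauchy-Schwarz produces its norm in L²(`μ`),
  -- independently of `ν`.
  have hCS : ∫ q, G q.1 * dist q.1 q.2 ∂(π : Measure (X × X)) ≤ S * t := by
    have hcs := integral_mul_le_Lp_mul_Lq_of_nonneg (μ := (π : Measure (X × X)))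
      Real.HolderConjugate.two_two (f := fun q : X × X => G q.1)
      (g := fun q : X × X => dist q.1 q.2) (Filter.Eventually.of_forall fun q => hG0 q.1)
      (Filter.Eventually.of_forall fun q => dist_nonneg) (by simpa using hG') (by simpa using hd')
    have e1 : ∫ q, G q.1 ^ 2 ∂(π : Measure (X × X)) = ∫ x, G x ^ 2 ∂(μ : Measure X) := by
      rw [← m1.map_eq, integral_map measurable_fst.aemeasurable
        (by rw [m1.map_eq]; exact hG.1.pow 2)]
    simp only [Real.rpow_ofNat, ← Real.sqrt_eq_rpow, e1] at hcs
    refine hcs.trans ?_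
    gcongr
    exact (Real.sqrt_le_sqrt hle).trans (Real.sqrt_sq ht0).le
  refine (integral_sub_le_of_mem_couplings hπ hμ hν (hprod.add (hi.const_mul (α : ℝ)))
    fun q => hf q.1 q.2).trans ?_
  simp only [Pi.add_apply]
  rw [integral_add hprod (hi.const_mul _), integral_const_mul]
  gcongr

end Distance

section Smooth

variable {d : ℕ}

/-- Mean value inequality for `f` minus its linear part at `x`, whose gradient along the segment is
at most α‖y - x‖. Convexity keeps the segment in `K`. -/
lemma IsSmoothOn.abs_sub_le {α : ℝ≥0} {K : Set (EuclideanSpace ℝ (Fin d))}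
    {f : EuclideanSpace ℝ (Fin d) → ℝ} {g : EuclideanSpace ℝ (Fin d) → EuclideanSpace ℝ (Fin d)}
    (h : IsSmoothOn α K f g) (hK : Convex ℝ K) {x y : EuclideanSpace ℝ (Fin d)} (hx : x ∈ K)
    (hy : y ∈ K) : |f y - f x| ≤ ‖g x‖ * ‖y - x‖ + α * ‖y - x‖ ^ 2 := by
  have hseg : segment ℝ x y ⊆ K := hK.segment_subset hx hy
  let T := InnerProductSpace.toDual ℝ (EuclideanSpace ℝ (Fin d))
  have hder : ∀ z ∈ segment ℝ x y,
      HasFDerivWithinAt (fun z => f z - T (g x) z) (T (g z) - T (g x)) (segment ℝ x y) z :=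
    fun z hz => ((h.hasGradient z (hseg hz)).hasFDerivWithinAt.mono hseg).sub
      (T (g x)).hasFDerivWithinAt
  have hbound : ∀ z ∈ segment ℝ x y, ‖T (g z) - T (g x)‖ ≤ α * ‖y - x‖ := fun z hz => by
    rw [← map_sub, LinearIsometryEquiv.norm_map]
    refine (h.lipschitz.norm_sub_le (hseg hz) hx).trans ?_
    gcongr
    exact norm_sub_le_of_mem_segment hz
  have hmv := (convex_segment x y).norm_image_sub_le_of_norm_hasFDerivWithin_le hder hbound
    (left_mem_segment ℝ x y) (right_mem_segment ℝ x y)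
  have hin : |T (g x) (y - x)| ≤ ‖g x‖ * ‖y - x‖ := by
    have := (T (g x)).le_opNorm (y - x)
    rwa [LinearIsometryEquiv.norm_map, Real.norm_eq_abs] at this
  have heq : f y - f x = ((f y - T (g x) y) - (f x - T (g x) x)) + T (g x) (y - x) := by
    rw [map_sub]; ring
  rw [heq]
  refine (abs_add_le _ _).trans ?_
  rw [Real.norm_eq_abs] at hmv
  linarith

end Smooth

/-! ### Second moments of the clean law about its mean and about `z₀`. -/

section Moments

variable {d : ℕ} {Z : Set (EuclideanSpace ℝ (Fin d))}

/-- The left side is the trace of the covariance, at most the trace d of the identity. -/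
lemma lintegral_edist_mean_sq_le {μ : ProbabilityMeasure Z} (hμ : μ ∈ covClass Z) :
    ∫⁻ z : Z, edist (z : EuclideanSpace ℝ (Fin d)) (mean μ) ^ 2 ∂(μ : Measure Z)
      ≤ ENNReal.ofReal (√d ^ 2) := by
  obtain ⟨hL, hpsd⟩ := hμ
  have hmean : ∀ i, mean μ i = ∫ z : Z, (z : EuclideanSpace ℝ (Fin d)) i ∂(μ : Measure Z) :=
    fun i => ((EuclideanSpace.proj i : EuclideanSpace ℝ (Fin d) →L[ℝ] ℝ).integral_comp_comm
      (hL.integrable one_le_two)).symm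
  have hc : MemLp (fun z : Z => (z : EuclideanSpace ℝ (Fin d)) - mean μ) 2 (μ : Measure Z) :=
    hL.sub (memLp_const _)
  have hsq := hc.integrable_norm_pow two_ne_zero
  have hci : ∀ i, Integrable (fun z : Z => ((z : EuclideanSpace ℝ (Fin d)) i - mean μ i) *
      ((z : EuclideanSpace ℝ (Fin d)) i - mean μ i)) (μ : Measure Z) := fun i => by
    have hi : MemLp (fun z : Z => (z : EuclideanSpace ℝ (Fin d)) i - mean μ i) 2 (μ : Measure Z) :=
      (EuclideanSpace.proj i : EuclideanSpace ℝ (Fin d) →L[ℝ] ℝ).comp_memLp' hc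
    exact hi.integrable_mul hi
  have htr : (covMatrix μ).trace ≤ d := by
    have := hpsd.trace_nonneg
    rw [Matrix.trace_sub, Matrix.trace_one, Fintype.card_fin] at this
    linarith
  have hval : ∫ z : Z, ‖(z : EuclideanSpace ℝ (Fin d)) - mean μ‖ ^ 2 ∂(μ : Measure Z)
      = (covMatrix μ).trace := by
    simp only [EuclideanSpace.real_norm_sq_eq, PiLp.sub_apply]
    simp only [sq]
    rw [integral_finsetSum _ fun i _ => hci i]
    simp only [Matrix.trace, covMatrix, Matrix.diag, Matrix.of_apply, covariance, hmean]
  rw [Real.sq_sqrt (Nat.cast_nonneg d)]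
  have he : ∀ z : Z, edist (z : EuclideanSpace ℝ (Fin d)) (mean μ) ^ 2
      = ENNReal.ofReal (‖(z : EuclideanSpace ℝ (Fin d)) - mean μ‖ ^ 2) := fun z => by
    rw [edist_dist, dist_eq_norm, ENNReal.ofReal_pow (norm_nonneg _)]
  simp only [he]
  rw [← ofReal_integral_eq_lintegral_ofReal hsq (Filter.Eventually.of_forall fun z => by positivity),
    hval]
  exact ENNReal.ofReal_le_ofReal htr

lemma lintegral_edist_sq_le_of_norm_sub_le {μ : ProbabilityMeasure Z}
    {c c' : EuclideanSpace ℝ (Fin d)} {a R : ℝ} (ha : 0 ≤ a) (hR : ‖c' - c‖ ≤ R)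
    (h : ∫⁻ z : Z, edist (z : EuclideanSpace ℝ (Fin d)) c ^ 2 ∂(μ : Measure Z)
      ≤ ENNReal.ofReal (a ^ 2)) :
    ∫⁻ z : Z, edist (z : EuclideanSpace ℝ (Fin d)) c' ^ 2 ∂(μ : Measure Z)
      ≤ ENNReal.ofReal ((a + R) ^ 2) := by
  have hR0 : 0 ≤ R := (norm_nonneg _).trans hR
  rw [← ENNReal.rpow_le_rpow_iff (by norm_num : (0 : ℝ) < 1 / 2), ofReal_sq_rpow_half (by positivity),
    ENNReal.ofReal_add ha hR0]
  have hmink := ENNReal.lintegral_Lp_add_le (μ := (μ : Measure Z)) (p := 2)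
    (f := fun z : Z => edist (z : EuclideanSpace ℝ (Fin d)) c) (g := fun _ => ENNReal.ofReal R)
    (by fun_prop) (by fun_prop) (by norm_num)
  simp only [Pi.add_apply, ENNReal.rpow_ofNat, lintegral_const, measure_univ, mul_one] at hmink
  calc (∫⁻ z : Z, edist (z : EuclideanSpace ℝ (Fin d)) c' ^ 2 ∂(μ : Measure Z)) ^ (1 / 2 : ℝ)
      ≤ (∫⁻ z : Z, (edist (z : EuclideanSpace ℝ (Fin d)) c + ENNReal.ofReal R) ^ 2
          ∂(μ : Measure Z)) ^ (1 / 2 : ℝ) := by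
        gcongr with z
        refine (edist_triangle _ c _).trans ?_
        gcongr
        rw [edist_comm, edist_dist, dist_eq_norm]
        exact ENNReal.ofReal_le_ofReal hR
    _ ≤ _ := hmink
    _ ≤ ENNReal.ofReal a + ENNReal.ofReal R := by
        rw [← ENNReal.ofReal_pow hR0, ofReal_sq_rpow_half hR0, ← ofReal_sq_rpow_half ha]
        gcongr

lemma mem_secondMomentClass_of_mem_covClass {μ : ProbabilityMeasure Z} (hμ : μ ∈ covClass Z)
    {z₀ : Z} {R : ℝ} (hR : ‖(z₀ : EuclideanSpace ℝ (Fin d)) - mean μ‖ ≤ R) :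
    μ ∈ secondMomentClass (√d + R) z₀ :=
  lintegral_edist_sq_le_of_norm_sub_le (Real.sqrt_nonneg _) hR (lintegral_edist_mean_sq_le hμ)

lemma memLp_of_mem_secondMomentClass {ν : ProbabilityMeasure Z} {σ : ℝ} {z₀ : Z}
    (hν : ν ∈ secondMomentClass σ z₀) :
    MemLp (fun z : Z => ‖(z : EuclideanSpace ℝ (Fin d)) - z₀‖) 2 (ν : Measure Z) := by
  have hm : AEStronglyMeasurable (fun z : Z => ‖(z : EuclideanSpace ℝ (Fin d)) - z₀‖)
      (ν : Measure Z) := Measurable.aestronglyMeasurable (by fun_prop)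
  refine (memLp_two_iff_integrable_sq hm).2 ⟨hm.pow 2, ?_⟩
  rw [hasFiniteIntegral_iff_ofReal (Filter.Eventually.of_forall fun z => by positivity)]
  refine lt_of_le_of_lt (le_of_eq ?_) (lt_of_le_of_lt hν ENNReal.ofReal_lt_top)
  refine lintegral_congr fun z => ?_
  rw [Subtype.edist_eq, edist_dist, dist_eq_norm, ENNReal.ofReal_pow (norm_nonneg _)]

lemma lintegral_ofReal_ne_top_of_growth {μ : ProbabilityMeasure Z}
    (hμ : MemLp (fun z : Z => (z : EuclideanSpace ℝ (Fin d))) 2 (μ : Measure Z)) {p : ℝ}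
    (hp : p = 1 ∨ p = 2) {f : Z → ℝ} {B : ℝ}
    (hf : ∀ z : Z, f z ≤ B * (1 + ‖(z : EuclideanSpace ℝ (Fin d))‖ ^ p)) :
    ∫⁻ z, ENNReal.ofReal (f z) ∂(μ : Measure Z) ≠ ∞ := by
  have hi : Integrable (fun z : Z => ‖(z : EuclideanSpace ℝ (Fin d))‖ ^ p) (μ : Measure Z) := by
    rcases hp with rfl | rfl
    · simpa using (hμ.integrable one_le_two).norm
    · simpa using hμ.integrable_norm_pow two_ne_zero
  have := (((integrable_const (1 : ℝ)).add hi).const_mul B).lintegral_lt_top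
  exact ((lintegral_mono fun z => ENNReal.ofReal_le_ofReal (hf z)).trans_lt this).ne

end Moments

/-! ### Quantitative closeness of feasible laws, uniformly in p. -/

section Feasible

variable {d : ℕ} {Z : Set (EuclideanSpace ℝ (Fin d))}

/-- The parameter `t` treats both exponents at once. The trimming level `e` will be ε or ε/(1 - ε),
and √e ≤ 2√ε doubles the constant 7. -/
lemma wass_le_fourteen_mul {p ε t e : ℝ} (hpt : p = 1 ∧ t = √ε ∨ p = 2 ∧ t = 1) (hε : 0 ≤ ε)
    (he0 : 0 ≤ e) (he : e ≤ 49 / 51) (heε : e ≤ 4 * ε) {ν ν' : ProbabilityMeasure Z}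
    (h : ν' ∈ trimmings e ν) {c : EuclideanSpace ℝ (Fin d)} {s : ℝ} (hs0 : 0 ≤ s)
    (hs : ∫⁻ z : Z, edist (z : EuclideanSpace ℝ (Fin d)) c ^ 2 ∂(ν : Measure Z)
      ≤ ENNReal.ofReal (s ^ 2)) :
    wass p ν' ν ≤ ENNReal.ofReal (14 * (t * s)) := by
  have hφ : Measurable fun z : Z => edist (z : EuclideanSpace ℝ (Fin d)) c := by fun_prop
  have hd : ∀ x y : Z, edist x y ≤ edist (x : EuclideanSpace ℝ (Fin d)) c
      + edist (y : EuclideanSpace ℝ (Fin d)) c := fun x y =>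
    edist_triangle_right (x : EuclideanSpace ℝ (Fin d)) y c
  rcases hpt with ⟨rfl, rfl⟩ | ⟨rfl, rfl⟩
  · refine (wass_one_le_seven_mul he0 he h hφ hd hs0 hs).trans (ENNReal.ofReal_le_ofReal ?_)
    have h2 : √e ≤ 2 * √ε := by
      rw [Real.sqrt_le_left (by positivity), mul_pow, Real.sq_sqrt hε]
      linarith
    have h3 := mul_le_mul_of_nonneg_right h2 hs0
    linarith
  · refine (wass_two_le_seven_mul he h hφ hd hs0 hs).trans (ENNReal.ofReal_le_ofReal ?_)
    linarith

lemma ofReal_rpow_one_div_le {p a b : ℝ} (hp : 1 ≤ p) (hb : 1 ≤ b) (hab : a ≤ b) :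
    ENNReal.ofReal a ^ (1 / p) ≤ ENNReal.ofReal b := by
  have hp0 : 0 < p := by linarith
  calc ENNReal.ofReal a ^ (1 / p) ≤ ENNReal.ofReal b ^ (1 / p) := by gcongr
    _ ≤ ENNReal.ofReal b ^ (1 : ℝ) :=
        ENNReal.rpow_le_rpow_of_exponent_le (by simpa using hb) ((div_le_one hp0).2 hp)
    _ = _ := ENNReal.rpow_one _

/-- The clean distribution is feasible, and every feasible distribution is close to it. -/
lemma feasible_and_wass_le (hZ : IsClosed Z) {p ε ρ₀ δ R t C₀ : ℝ}
    (hpt : p = 1 ∧ t = √ε ∨ p = 2 ∧ t = 1) (hε0 : 0 ≤ ε) (hε : ε ≤ 0.49) (hρ₀ : 0 ≤ ρ₀)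
    (hδ : 0 ≤ δ) {μ μt μh : ProbabilityMeasure Z} (hμ : μ ∈ covClass Z)
    (h₁ : robustWass p ε μt μh ≤ ENNReal.ofReal ρ₀) (h₂ : wass p μh μ ≤ ENNReal.ofReal δ)
    {z₀ : Z} (hR : ‖(z₀ : EuclideanSpace ℝ (Fin d)) - mean μ‖ ≤ R) (hRC : R ≤ C₀ * (ρ₀ + √d))
    {ρ : ℝ≥0∞} (hρ : ρ = ENNReal.ofReal ((ρ₀ + δ) * (1 - ε) ^ (-1 / p))
      + resilience p (covClass Z) ε) :
    oneSidedRobustWass p ε μt μ ≤ ρ ∧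
      ∀ ν ∈ secondMomentClass (√d + R) z₀, oneSidedRobustWass p ε μt ν ≤ ρ →
        wass p μ ν ≤ ENNReal.ofReal ((756 + 28 * |C₀|) * (ρ₀ + t * √d + δ)) := by
  have : Nonempty Z := ⟨z₀⟩
  have : StandardBorelSpace Z := hZ.measurableSet.standardBorel
  have hε' : ε ≤ 49 / 100 := by norm_num at hε ⊢; exact hε
  have h1ε : 0 < 1 - ε := by linarith
  have hp : 1 ≤ p := by rcases hpt with ⟨rfl, -⟩ | ⟨rfl, -⟩ <;> norm_num
  have ht0 : 0 ≤ t := by rcases hpt with h | h <;> rw [h.2] <;> positivity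
  have ht1 : t ≤ 1 := by
    rcases hpt with ⟨-, rfl⟩ | ⟨-, rfl⟩
    · exact Real.sqrt_le_one.2 (by linarith)
    · exact le_rfl
  have hR0 : 0 ≤ R := (norm_nonneg _).trans hR
  have hd0 : 0 ≤ √(d : ℝ) := Real.sqrt_nonneg _
  have hres : resilience p (covClass Z) ε ≤ ENNReal.ofReal (14 * (t * √d)) :=
    iSup₂_le fun η hη => iSup₂_le fun η' hη' =>
      wass_le_fourteen_mul hpt hε0 hε0 (by linarith) (by linarith) hη' hd0
        (lintegral_edist_mean_sq_le hη)
  have hpow : ENNReal.ofReal ((1 - ε) ^ (-1 / p)) = ENNReal.ofReal (1 - ε)⁻¹ ^ (1 / p) := by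
    rw [ENNReal.ofReal_rpow_of_nonneg (by positivity) (by positivity), neg_div,
      Real.rpow_neg h1ε.le, Real.inv_rpow h1ε.le]
  have hpow2 : ENNReal.ofReal ((1 - ε) ^ (-1 / p)) ≤ ENNReal.ofReal 2 := by
    rw [hpow]
    refine ofReal_rpow_one_div_le hp (by norm_num) ?_
    exact (inv_anti₀ (by norm_num) (by linarith : (1 / 2 : ℝ) ≤ 1 - ε)).trans (by norm_num)
  have hρle : ρ ≤ ENNReal.ofReal (2 * (ρ₀ + δ) + 14 * (t * √d)) := by
    rw [hρ, ENNReal.ofReal_add (by positivity) (by positivity), ENNReal.ofReal_mul (by positivity),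
      mul_comm, ENNReal.ofReal_mul zero_le_two]
    gcongr
  have hfeas : oneSidedRobustWass p ε μt μ ≤ ρ := by
    refine (oneSidedRobustWass_le_of_robustWass_le hp hε0 (by linarith) ENNReal.ofReal_ne_top h₁ h₂
      ENNReal.ofReal_ne_top (T := resilience p (covClass Z) ε) fun μ' hμ' =>
        le_iSup₂_of_le μ hμ (le_iSup₂_of_le μ' hμ' le_rfl)).trans (le_of_eq ?_)
    rw [hρ, ENNReal.ofReal_mul (by positivity), hpow, ENNReal.ofReal_add hρ₀ hδ, mul_comm]
  refine ⟨hfeas, fun ν hν hνρ => ?_⟩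
  have he0 : 0 ≤ ε / (1 - ε) := by positivity
  have he : ε / (1 - ε) ≤ 49 / 51 := by rw [div_le_iff₀ h1ε]; linarith
  have heε : ε / (1 - ε) ≤ 4 * ε := by rw [div_le_iff₀ h1ε]; nlinarith
  have hσ0 : 0 ≤ √d + R := by positivity
  have hμ2 := mem_secondMomentClass_of_mem_covClass hμ hR
  have hT : ∀ η ∈ secondMomentClass (√d + R) z₀, ∀ η' ∈ trimmings (ε / (1 - ε)) η,
      wass p η' η ≤ ENNReal.ofReal (14 * (t * (√d + R))) := fun η hη η' hη' =>
    wass_le_fourteen_mul hpt hε0 he0 he heε hη' hσ0 hη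
  refine (wass_le_of_oneSidedRobustWass_le hp (by linarith)
    (hρle.trans_lt ENNReal.ofReal_lt_top).ne hfeas hνρ (hT μ hμ2) (hT ν hν)).trans ?_
  have hk : ENNReal.ofReal (1 - ε / (1 - ε))⁻¹ ^ (1 / p) ≤ ENNReal.ofReal 26 := by
    refine ofReal_rpow_one_div_le hp (by norm_num) ?_
    exact (inv_anti₀ (by norm_num) (by linarith : (2 / 51 : ℝ) ≤ 1 - ε / (1 - ε))).trans
      (by norm_num)
  calc 2 * (ENNReal.ofReal (1 - ε / (1 - ε))⁻¹ ^ (1 / p) * ρ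
        + ENNReal.ofReal (14 * (t * (√d + R))))
      ≤ ENNReal.ofReal 2 * (ENNReal.ofReal 26 * ENNReal.ofReal (2 * (ρ₀ + δ) + 14 * (t * √d))
        + ENNReal.ofReal (14 * (t * (√d + R)))) := by
        rw [ENNReal.ofReal_ofNat 2]
        gcongr
    _ = ENNReal.ofReal (2 * (26 * (2 * (ρ₀ + δ) + 14 * (t * √d)) + 14 * (t * (√d + R)))) := by
        rw [← ENNReal.ofReal_mul (by positivity), ← ENNReal.ofReal_add (by positivity)
          (by positivity), ← ENNReal.ofReal_mul (by positivity)]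
    _ ≤ _ := by
        refine ENNReal.ofReal_le_ofReal ?_
        have hC : R ≤ |C₀| * (ρ₀ + √d) := hRC.trans (by gcongr; exact le_abs_self _)
        -- The factor `t` is dropped on ρ₀ by t ≤ 1 but kept on √d, so that √(dε) survives when p =
        -- 1. The total is 104(ρ₀ + δ) + (728 + 28)t√d + 28tR, whence 756 + 28|C₀|.
        have h3 : t * R ≤ |C₀| * ρ₀ + |C₀| * (t * √d) := by
          calc t * R ≤ t * (|C₀| * (ρ₀ + √d)) := by gcongr
            _ = t * (|C₀| * ρ₀) + |C₀| * (t * √d) := by ring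
            _ ≤ 1 * (|C₀| * ρ₀) + |C₀| * (t * √d) := by gcongr
            _ = _ := by ring
        have h4 : 0 ≤ t * √d := by positivity
        have h5 : 0 ≤ |C₀| * δ := by positivity
        nlinarith

end Feasible

lemma lipschitzWith_lipSeminorm {X : Type*} [PseudoMetricSpace X] {f : X → ℝ}
    (h : ∃ K, LipschitzWith K f) : LipschitzWith (lipSeminorm f) f := by
  have hclosed : IsClosed {K : ℝ≥0 | LipschitzWith K f} := by
    simp only [lipschitzWith_iff_dist_le_mul, Set.ofPred_forall]
    exact isClosed_iInter fun x => isClosed_iInter fun y =>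
      isClosed_le continuous_const (by fun_prop)
  exact hclosed.csInf_mem h (OrderBot.bddBelow _)

/-! ### Integrability of Lipschitz and smooth losses on the moment class. -/

section Integrability

variable {d : ℕ} {Z : Set (EuclideanSpace ℝ (Fin d))}

lemma integrable_of_mem_secondMomentClass {ν : ProbabilityMeasure Z} {σ : ℝ} {z₀ : Z}
    (hν : ν ∈ secondMomentClass σ z₀) {f : Z → ℝ} {K : ℝ≥0}
    (hf : LipschitzWith K f) :
    Integrable f (ν : Measure Z) := by
  have h := (memLp_of_mem_secondMomentClass hν).integrable one_le_two
  refine ((integrable_const |f z₀|).add (h.const_mul (K : ℝ))).mono'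
    hf.continuous.measurable.aestronglyMeasurable (Filter.Eventually.of_forall fun z => ?_)
  have h1 := hf.dist_le_mul z z₀
  rw [Real.dist_eq, Subtype.dist_eq, dist_eq_norm] at h1
  have h2 := abs_add_le (f z - f z₀) (f z₀)
  rw [sub_add_cancel] at h2
  simp only [Pi.add_apply, Real.norm_eq_abs]
  linarith

variable {α : ℝ≥0} {f : EuclideanSpace ℝ (Fin d) → ℝ}
  {g : EuclideanSpace ℝ (Fin d) → EuclideanSpace ℝ (Fin d)}

lemma IsSmoothOn.integrable_of_mem_secondMomentClass (h : IsSmoothOn α (convexHull ℝ Z) f g)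
    {ν : ProbabilityMeasure Z} {σ : ℝ} {z₀ : Z} (hν : ν ∈ secondMomentClass σ z₀) :
    Integrable (fun z : Z => f z) (ν : Measure Z) := by
  have hL := memLp_of_mem_secondMomentClass hν
  have hcont : Continuous fun z : Z => f z := by
    refine continuousOn_iff_continuous_domRestrict.1 fun z hz => ?_
    exact ((h.hasGradient z (subset_convexHull ℝ Z hz)).hasFDerivWithinAt.continuousWithinAt).mono
      (subset_convexHull ℝ Z)
  have hi := hL.integrable_norm_pow two_ne_zero
  simp only [norm_norm] at hi
  refine (((integrable_const |f z₀|).add ((hL.integrable one_le_two).const_mul ‖g z₀‖)).add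
    (hi.const_mul (α : ℝ))).mono'
    hcont.measurable.aestronglyMeasurable (Filter.Eventually.of_forall fun z => ?_)
  have h1 := h.abs_sub_le (convex_convexHull ℝ Z) (subset_convexHull ℝ Z z₀.2)
    (subset_convexHull ℝ Z z.2)
  have h2 := abs_add_le (f z - f z₀) (f z₀)
  rw [sub_add_cancel] at h2
  simp only [Pi.add_apply, Real.norm_eq_abs]
  linarith

lemma IsSmoothOn.memLp_norm_gradient (h : IsSmoothOn α (convexHull ℝ Z) f g)
    {ν : ProbabilityMeasure Z} {σ : ℝ} {z₀ : Z} (hν : ν ∈ secondMomentClass σ z₀) :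
    MemLp (fun z : Z => ‖g z‖) 2 (ν : Measure Z) := by
  have hlip := h.lipschitz.mono (subset_convexHull ℝ Z)
  have hcont : Continuous fun z : Z => g z :=
    continuousOn_iff_continuous_domRestrict.1 hlip.continuousOn
  refine ((memLp_const ‖g z₀‖).add
    ((memLp_of_mem_secondMomentClass hν).const_mul (α : ℝ))).mono'
    hcont.norm.measurable.aestronglyMeasurable (Filter.Eventually.of_forall fun z => ?_)
  have h1 := hlip.norm_sub_le z.2 z₀.2
  have h2 := norm_add_le (g z - g z₀) (g z₀)
  rw [sub_add_cancel] at h2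
  simp only [Pi.add_apply, norm_norm]
  linarith

end Integrability

end RobustDRO

/-! ### The excess risk bounds. -/

theorem mainTheorem6 :
    ∀ C₀ : ℝ, ∃ C : ℝ,
      ∀ (d : ℕ) (Z : Set (EuclideanSpace ℝ (Fin d))), IsClosed Z →
      ∀ (p ε ρ₀ δ R : ℝ), 0 ≤ ε → ε ≤ 0.49 → 0 ≤ ρ₀ → 0 ≤ δ →
      -- the family of losses; at the end `p` is `1` or `2`
      ∀ ℒ : Set (Z → ℝ),
        (∀ ℓ ∈ ℒ, LowerSemicontinuous ℓ ∧
          ∃ B : ℝ, ∀ z : Z, ℓ z ≤ B * (1 + ‖(z : EuclideanSpace ℝ (Fin d))‖ ^ p)) →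
      -- the clean distribution, the clean sample and the corrupted sample
      ∀ (𝒢 : Set (ProbabilityMeasure Z)), 𝒢 ⊆ RobustDRO.covClass Z →
      ∀ μ ∈ 𝒢, ∀ (n : ℕ) [NeZero n] (x xt : Fin n → Z),
        RobustDRO.robustWass p ε (RobustDRO.empirical xt) (RobustDRO.empirical x)
          ≤ ENNReal.ofReal ρ₀ →
        RobustDRO.wass p (RobustDRO.empirical x) μ ≤ ENNReal.ofReal δ →
      -- the centre
      ∀ z₀ : Z, ‖(z₀ : EuclideanSpace ℝ (Fin d)) - RobustDRO.mean μ‖ ≤ R →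
        R ≤ C₀ * (ρ₀ + √d) →
      -- the learned loss solves the modified problem
      ∀ ℓhat ∈ ℒ,
        IsMinOn
          (RobustDRO.worstRisk p ε (√d + R)
            (ENNReal.ofReal ((ρ₀ + δ) * (1 - ε) ^ (-1 / p))
              + RobustDRO.resilience p (RobustDRO.covClass Z) ε)
            z₀ (RobustDRO.empirical xt)) ℒ ℓhat →
      -- the optimal loss
      ∀ ℓstar ∈ ℒ, IsMinOn (RobustDRO.expect μ) ℒ ℓstar →
        (p = 1 → (∃ K, LipschitzWith K ℓstar) →
          Integrable ℓhat (μ : Measure Z) ∧ Integrable ℓstar (μ : Measure Z) ∧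
          (∫ z, ℓhat z ∂(μ : Measure Z)) - (∫ z, ℓstar z ∂(μ : Measure Z))
            ≤ C * (RobustDRO.lipSeminorm ℓstar * (ρ₀ + √(d * ε) + δ))) ∧
        (p = 2 → ∀ (α : ℝ≥0) (f : EuclideanSpace ℝ (Fin d) → ℝ)
            (g : EuclideanSpace ℝ (Fin d) → EuclideanSpace ℝ (Fin d)),
          (∀ z : Z, f z = ℓstar z) → RobustDRO.IsSmoothOn α (convexHull ℝ Z) f g →
          Integrable ℓhat (μ : Measure Z) ∧ Integrable ℓstar (μ : Measure Z) ∧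
          (∫ z, ℓhat z ∂(μ : Measure Z)) - (∫ z, ℓstar z ∂(μ : Measure Z))
            ≤ C * (RobustDRO.sobolevSeminorm μ g * (ρ₀ + √d + δ)
                + α * (ρ₀ + √d + δ) ^ 2)) := by
  intro C₀
  set K : ℝ := 756 + 28 * |C₀| with hK
  have hK1 : 1 ≤ K := by linarith [abs_nonneg C₀]
  -- The quadratic term α`W_2`² needs `K ^ 2`; the linear terms need only `K`, which is smaller as
  -- `K` ≥ 1.
  refine ⟨K ^ 2, ?_⟩
  intro d Z hZ p ε ρ₀ δ R hε0 hε hρ₀ hδ ℒ hℒ 𝒢 h𝒢 μ hμ𝒢 n _ x xt h₁ h₂ z₀ hR hRC ℓhat hhat hminhat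
    ℓstar hstar hminstar
  have hμ := h𝒢 hμ𝒢
  have hKK : K ≤ K ^ 2 := by nlinarith
  obtain ⟨hlsc, B, hB⟩ := hℒ ℓhat hhat
  have hμ2 := RobustDRO.mem_secondMomentClass_of_mem_covClass hμ hR
  refine ⟨?_, ?_⟩
  · rintro rfl hLip
    obtain ⟨hfeas, hclose⟩ := RobustDRO.feasible_and_wass_le hZ (Or.inl ⟨rfl, rfl⟩) hε0 hε hρ₀ hδ
      hμ h₁ h₂ hR hRC rfl
    have hL := RobustDRO.lipschitzWith_lipSeminorm hLip
    refine RobustDRO.integrable_and_integral_sub_le hμ2 hfeas hlsc.measurable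
      (RobustDRO.lintegral_ofReal_ne_top_of_growth hμ.1 (Or.inl rfl) hB)
      (fun ν hν => RobustDRO.integrable_of_mem_secondMomentClass hν hL)
      (fun ν hν hνρ => ?_) (hminhat hstar) (hminstar hhat)
    refine (RobustDRO.integral_sub_le_of_wass_one_le hL
      (RobustDRO.integrable_of_mem_secondMomentClass hμ2 hL)
      (RobustDRO.integrable_of_mem_secondMomentClass hν hL) (by positivity)
      (hclose ν hν hνρ)).trans ?_
    rw [← hK, Real.sqrt_mul (Nat.cast_nonneg d), mul_comm √(d : ℝ), mul_left_comm]
    gcongr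
  · rintro rfl α f g hfℓ hsm
    obtain ⟨hfeas, hclose⟩ := RobustDRO.feasible_and_wass_le hZ (Or.inr ⟨rfl, rfl⟩) hε0 hε hρ₀ hδ
      hμ h₁ h₂ hR hRC rfl
    have hfun : ℓstar = fun z : Z => f z := funext fun z => (hfℓ z).symm
    have hint : ∀ ν ∈ RobustDRO.secondMomentClass (√d + R) z₀,
        Integrable ℓstar (ν : Measure Z) := fun ν hν => by
      rw [hfun]; exact hsm.integrable_of_mem_secondMomentClass hν
    refine RobustDRO.integrable_and_integral_sub_le hμ2 hfeas hlsc.measurable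
      (RobustDRO.lintegral_ofReal_ne_top_of_growth hμ.1 (Or.inr rfl) hB) hint
      (fun ν hν hνρ => ?_) (hminhat hstar) (hminstar hhat)
    refine (RobustDRO.integral_sub_le_of_wass_two_le (hsm.memLp_norm_gradient hμ2)
      (fun z => norm_nonneg _) (α := α) (fun z w => ?_) (hint μ hμ2) (hint ν hν) (by positivity)
      (hclose ν hν hνρ)).trans ?_
    · rw [hfun, dist_comm, Subtype.dist_eq, dist_eq_norm]
      exact (le_abs_self _).trans (hsm.abs_sub_le (convex_convexHull ℝ Z)
        (subset_convexHull ℝ Z z.2) (subset_convexHull ℝ Z w.2))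
    · rw [← hK, one_mul, mul_add (K ^ 2), mul_left_comm, mul_pow, mul_left_comm (α : ℝ)]
      change K * (RobustDRO.sobolevSeminorm μ g * _) + _ ≤ _
      have hS : 0 ≤ RobustDRO.sobolevSeminorm μ g := Real.sqrt_nonneg _
      gcongr
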